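/- Let $k$ be a field of prime characteristic $p$ and let $0\le r\le n$ be integers. Let $\bar\tau_r$ be the monoid (under composition) of all maps $\alpha:\{0,\dots,r\}\to\{0,\dots,r\}$ with $\alpha(0)=0$. Let $\mathfrak S_r,\tau_r,\Re_r\subseteq\bar\tau_r$ be the submonoids of, respectively, the bijective $\alpha$; the $\alpha$ with $\alpha^{-1}(0)=\{0\}$; and the $\alpha$ with $|\alpha^{-1}(i)|\le1$ for all $i\neq0$. Let $S_r$ be a monoid with $\mathfrak S_r\subseteq S_r\subseteq\bar\tau_r$. Let $\Lambda$ be the set of compositions $\lambda=(\lambda_1,\dots,\lambda_n)$ of $r$ with $n$ parts $\lambda_i\ge0$. The blocks of $\lambda$ are the sets $b_i^\lambda=\{x:\lambda_1+\dots+\lambda_{i-1}<x\le\lambda_1+\dots+\lambda_i\}$, and $G_\lambda\subseteq\mathfrak S_r$ is the Young subgroup of permutations that preserve each block. For $\lambda,\mu\in\Lambda$ let ${}_\lambda M_\mu$ be the set of double cosets $D_\alpha=G_\lambda\alpha G_\mu$, $\alpha\in S_r$. For $D=D_\alpha\in{}_\lambda M_\mu$ put $n_L(D)=\#\{\pi\in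 G_\mu:\exists\sigma\in G_\lambda,\ \alpha\pi=\sigma\alpha\}$. For $D_\alpha\in{}_\lambda M_\nu$, $D_\beta\in{}_\nu M_\mu$, $D\in{}_\lambda M_\mu$ put $N(D_\alpha,D_\beta,D)=\#\{\rho\in G_\nu:\alpha\rho\beta\in D\}$. (These numbers do not depend on the chosen representatives.) The left generalized Schur algebra $B_L$ is the $k$-algebra with basis $\{f(\lambda,D,\mu):\lambda,\mu\in\Lambda,\ D\in{}_\lambda M_\mu\}$ and product $$f(\lambda,D_1,\nu)\,f(\nu,D_2,\mu)=\sum_{D\in{}_\lambda M_\mu}\frac{n_L(D)\,N(D_1,D_2,D)}{n_L(D_1)\,n_L(D_2)}\,f(\lambda,D,\mu),$$ where the coefficients are integers, read in $k$, and $f(\lambda,D_1,\nu)f(\omega,D_2,\mu)=0$ if $\nu\ne\omega$. Write $f(\lambda,\alpha,\mu)=f(\lambda,D_\alpha,\mu)$ and let $1_\lambda$ be the idempotent $f(\lambda,1,\lambda)$. For $\mu,\lambda\in\Lambda$ write $\mu<\lambda$ if the decreasing rearrangement of $\mu$ is lexicographically smaller than that of $\lambda$. Put $e_\lambda=\sum_{\mu<\lambda}1_\mu$,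 $B_L^\lambda=1_\lambda B_L1_\lambda$ (an algebra with unit $1_\lambda$) and $C_L^\lambda=B_L^\lambda/(B_Le_\lambda B_L\cap B_L^\lambda)$, and let $\Pi_L:B_L^\lambda\to C_L^\lambda$ be the projection. Let $\lambda\in\Lambda$ be a $p$-partition, that is, $\lambda_1\ge\dots\ge\lambda_n$ and each nonzero $\lambda_i$ is a power of $p$ (possibly $p^0=1$). Put $s_i=\#\{j:\lambda_j=p^i\}$ and $c_i=\sum_{j>i}s_jp^j$. Let $\phi_\lambda:\prod_{i\ge0}\bar\tau_{s_i}\to\bar\tau_r$ send $(\alpha_i)$ to the map $\alpha$ with $\alpha(0)=0$ and, for $1\le a\le s_i$, $1\le b\le p^i$, $\alpha(c_i+(a-1)p^i+b)=c_i+(\alpha_i(a)-1)p^i+b$ if $\alpha_i(a)\ne0$, and $=0$ if $\alpha_i(a)=0$. Put $S_{r,L}^\lambda=\phi_\lambda\bigl(\bar\tau_{s_0}\times\prod_{i>0}\mathfrak S_{s_i}\bigr)\cap S_r$, a monoid, and let $\psi_{\lambda,L}:k[S_{r,L}^\lambda]\to B_L^\lambda$ be the $k$-linear map with $\alpha\mapsto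 f(\lambda,\alpha,\lambda)$. Proposition 8.1. For every $p$-partition $\lambda$, the map $\Pi_L\circ\psi_{\lambda,L}:k[S_{r,L}^\lambda]\to C_L^\lambda$ is an isomorphism of $k$-algebras. Moreover, there is a submonoid $S_0$ of $\bar\tau_{s_0}$ containing $\mathfrak S_{s_0}$ such that $S_{r,L}^\lambda=\phi_\lambda\bigl(S_0\times\prod_{i>0}\mathfrak S_{s_i}\bigr)$ and, as $k$-algebras, $$C_L^\lambda\cong k[S_0]\otimes_k\bigotimes_{i>0,\ s_i>0}k[\mathfrak S_{s_i}].$$ For $S_r=\mathfrak S_r,\ \tau_r,\ \Re_r,\ \bar\tau_r$ one has $S_0=\mathfrak S_{s_0},\ \tau_{s_0},\ \Re_{s_0},\ \bar\tau_{s_0}$, respectively. -/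

import Mathlib

namespace GSchur

section Corner

/-- The corner `e A e` of an algebra `A` at an idempotent `e` is an algebra with unit `e`. -/
instance cornerAlgebra {k A : Type*} [CommRing k] [Ring A] [Algebra k A] {e : A}
    (he : IsIdempotentElem e) : Algebra k he.Corner where
  smul c x := ⟨c • x.1, by
    obtain ⟨y, hy⟩ := x.2
    exact ⟨c • y, by simp only [← hy, mul_smul_comm, smul_mul_assoc]⟩⟩
  algebraMap :=
    { toFun := fun c => ⟨c • e, c • e, by simp only [mul_smul_comm, smul_mul_assoc, he.eq]⟩
      map_one' := Subtype.ext (one_smul k e)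
      map_mul' := fun c d => Subtype.ext (by
        change (c * d) • e = (c • e) * (d • e)
        rw [smul_mul_smul_comm, he.eq])
      map_zero' := Subtype.ext (zero_smul k e)
      map_add' := fun c d => Subtype.ext (add_smul c d e) }
  commutes' c x := Subtype.ext (by
    change (c • e) * x.1 = x.1 * (c • e)
    have := (Subsemigroup.mem_corner_iff he).1 x.2
    rw [smul_mul_assoc, mul_smul_comm, this.1, this.2])
  smul_def' c x := Subtype.ext (by
    change c • x.1 = (c • e) * x.1
    have := (Subsemigroup.mem_corner_iff he).1 x.2
    rw [smul_mul_assoc, this.1])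

/-- The two-sided ideal `A x A ∩ e A e` of the corner `e A e`, where `A x A` is the two-sided ideal
of `A` generated by `x`. -/
def cornerIdeal {A : Type*} [Ring A] {e : A} (he : IsIdempotentElem e) (x : A) :
    Ideal he.Corner where
  carrier := {y | y.1 ∈ TwoSidedIdeal.span {x}}
  add_mem' := fun {a b} ha hb => (TwoSidedIdeal.span {x}).add_mem ha hb
  zero_mem' := (TwoSidedIdeal.span {x}).zero_mem
  smul_mem' := fun c y hy => (TwoSidedIdeal.span {x}).mul_mem_left c.1 y.1 hy

instance {A : Type*} [Ring A] {e : A} (he : IsIdempotentElem e) (x : A) :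
    (cornerIdeal he x).IsTwoSided :=
  ⟨fun {a} b ha => (TwoSidedIdeal.span {x}).mul_mem_right a.1 b.1 ha⟩

end Corner

section DoubleCosetAlgebra

variable {M ι : Type*} [Monoid M]

/-- The relation on a monoid `M` whose classes are the double cosets `G i * a * G j`, for a family
`G` of subgroups of (the unit group of) `M`. -/
def dcSetoid (G : ι → Subgroup Mˣ) (i j : ι) : Setoid M where
  r := fun a b => ∃ σ ∈ G i, ∃ π ∈ G j, (σ : M) * a * (π : M) = b
  iseqv :=
    { refl := fun a => ⟨1, one_mem _, 1, one_mem _, by simp⟩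
      symm := by
        rintro a b ⟨σ, hσ, π, hπ, rfl⟩
        exact ⟨σ⁻¹, inv_mem hσ, π⁻¹, inv_mem hπ, by simp [mul_assoc]⟩
      trans := by
        rintro a b c ⟨σ, hσ, π, hπ, rfl⟩ ⟨σ', hσ', π', hπ', rfl⟩
        exact ⟨σ' * σ, mul_mem hσ' hσ, π * π', mul_mem hπ hπ', by simp [mul_assoc]⟩ }

/-- The set of double cosets `G i * a * G j`, `a ∈ M`. -/
def DC (G : ι → Subgroup Mˣ) (i j : ι) : Type _ := Quotient (dcSetoid G i j)

/-- The double coset `G i * a * G j` of `a`. -/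
def dc (G : ι → Subgroup Mˣ) (i j : ι) (a : M) : DC G i j := Quotient.mk (dcSetoid G i j) a

theorem dc_eq_iff {G : ι → Subgroup Mˣ} {i j : ι} {a b : M} :
    dc G i j a = dc G i j b ↔ ∃ σ ∈ G i, ∃ π ∈ G j, (σ : M) * a * (π : M) = b :=
  Quotient.eq (r := dcSetoid G i j)

theorem dc_surj {G : ι → Subgroup Mˣ} {i j : ι} (D : DC G i j) : ∃ a, dc G i j a = D :=
  Quotient.exists_rep D

noncomputable instance [Finite M] (G : ι → Subgroup Mˣ) (i j : ι) : Fintype (DC G i j) :=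
  @Fintype.ofFinite _ (inferInstanceAs (Finite (Quotient (dcSetoid G i j))))

/-- `G_L(i, a, j)`, the subgroup of those `π ∈ G j` which fix the left coset `G i * a`, that is,
for which there is `σ ∈ G i` with `a * π = σ * a`. -/
def stabL (G : ι → Subgroup Mˣ) (i j : ι) (a : M) : Subgroup Mˣ where
  carrier := {π | π ∈ G j ∧ ∃ σ ∈ G i, a * (π : M) = (σ : M) * a}
  one_mem' := ⟨one_mem _, 1, one_mem _, by simp⟩
  mul_mem' := by
    rintro π π' ⟨h, σ, hσ, e⟩ ⟨h', σ', hσ', e'⟩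
    refine ⟨mul_mem h h', σ * σ', mul_mem hσ hσ', ?_⟩
    rw [Units.val_mul, ← mul_assoc, e, mul_assoc, e', Units.val_mul, mul_assoc]
  inv_mem' := by
    rintro π ⟨h, σ, hσ, e⟩
    refine ⟨inv_mem h, σ⁻¹, inv_mem hσ, ?_⟩
    rw [Units.eq_inv_mul_iff_mul_eq, ← mul_assoc, Units.mul_inv_eq_iff_eq_mul, e]

theorem mem_stabL {G : ι → Subgroup Mˣ} {i j : ι} {a : M} {π : Mˣ} :
    π ∈ stabL G i j a ↔ π ∈ G j ∧ ∃ σ ∈ G i, a * (π : M) = (σ : M) * a := Iff.rfl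

/-- `n_L(D)`, the order of `G_L(i, a, j)` for any `a ∈ D`. -/
noncomputable def nL {G : ι → Subgroup Mˣ} {i j : ι} (D : DC G i j) : ℕ :=
  Quotient.lift (fun a => Nat.card (stabL G i j a)) (by
    rintro a b ⟨σ, hσ, π, hπ, rfl⟩
    refine Nat.card_congr
      { toFun := fun x => ⟨π⁻¹ * x.1 * π, ?_⟩
        invFun := fun x => ⟨π * x.1 * π⁻¹, ?_⟩
        left_inv := fun x => by ext; simp [mul_assoc]
        right_inv := fun x => by ext; simp [mul_assoc] }
    · obtain ⟨x, hx, τ, hτ, e⟩ := x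
      refine ⟨mul_mem (mul_mem (inv_mem hπ) hx) hπ, σ * τ * σ⁻¹,
        mul_mem (mul_mem hσ hτ) (inv_mem hσ), ?_⟩
      simp only [Units.val_mul, mul_assoc, Units.mul_inv_cancel_left, Units.inv_mul_cancel_left]
      rw [← mul_assoc a, e, mul_assoc]
    · obtain ⟨x, hx, τ, hτ, e⟩ := x
      refine ⟨mul_mem (mul_mem hπ hx) (inv_mem hπ), σ⁻¹ * τ * σ,
        mul_mem (mul_mem (inv_mem hσ) hτ) hσ, ?_⟩
      rw [Units.val_mul, ← mul_assoc, Units.mul_inv_eq_iff_eq_mul]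
      simp only [Units.val_mul, mul_assoc] at e ⊢
      rw [Units.eq_inv_mul_iff_mul_eq, e]) D

theorem nL_dc {G : ι → Subgroup Mˣ} {i j : ι} (a : M) :
    nL (dc G i j a) = Nat.card (stabL G i j a) := rfl

theorem dc_mul_mul {G : ι → Subgroup Mˣ} {i k : ι} {σ π : Mˣ} (hσ : σ ∈ G i) (hπ : π ∈ G k)
    (a : M) : dc G i k ((σ : M) * a * (π : M)) = dc G i k a :=
  (dc_eq_iff.2 ⟨σ, hσ, π, hπ, rfl⟩).symm

/-- `N(D₁, D₂, D)`, the number of `ρ ∈ G j` such that `a * ρ * b ∈ D`,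
for any `a ∈ D₁`, `b ∈ D₂`. -/
noncomputable def NN {G : ι → Subgroup Mˣ} {i j k : ι} (D₁ : DC G i j) (D₂ : DC G j k)
    (D : DC G i k) : ℕ :=
  Quotient.lift₂ (fun a b => Nat.card {ρ : Mˣ // ρ ∈ G j ∧ dc G i k (a * (ρ : M) * b) = D}) (by
    rintro a b _ _ ⟨σ, hσ, π, hπ, rfl⟩ ⟨σ', hσ', π', hπ', rfl⟩
    have key : ∀ x : M, dc G i k ((σ : M) * x * (π' : M)) = dc G i k x :=
      fun x => dc_mul_mul hσ hπ' x
    refine Nat.card_congr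
      { toFun := fun x => ⟨π⁻¹ * x.1 * σ'⁻¹, mul_mem (mul_mem (inv_mem hπ) x.2.1) (inv_mem hσ'), ?_⟩
        invFun := fun x => ⟨π * x.1 * σ', mul_mem (mul_mem hπ x.2.1) hσ', ?_⟩
        left_inv := fun x => by ext; simp [mul_assoc]
        right_inv := fun x => by ext; simp [mul_assoc] }
    · refine Eq.trans ?_ x.2.2
      rw [← key (a * (x.1 : M) * b)]
      congr 1
      simp [mul_assoc]
    · refine Eq.trans ?_ x.2.2
      rw [← key]
      congr 1
      simp [mul_assoc]) D₁ D₂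

theorem NN_dc {G : ι → Subgroup Mˣ} {i j k : ι} (a b : M) (D : DC G i k) :
    NN (dc G i j a) (dc G j k b) D =
      Nat.card {ρ : Mˣ // ρ ∈ G j ∧ dc G i k (a * (ρ : M) * b) = D} := rfl

/-- The structure constant `n_L(D) N(D₁, D₂, D) / (n_L(D₁) n_L(D₂))`; the division is exact, see
`nL_mul_nL_dvd`. -/
noncomputable def coef {G : ι → Subgroup Mˣ} {i j k : ι} (D₁ : DC G i j) (D₂ : DC G j k)
    (D : DC G i k) : ℕ :=
  nL D * NN D₁ D₂ D / (nL D₁ * nL D₂)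

open Classical in
theorem NN_dc_sum [Finite M] [Fintype Mˣ] {G : ι → Subgroup Mˣ} {i j k : ι} (a b : M)
    (D : DC G i k) : NN (dc G i j a) (dc G j k b) D =
      ∑ ρ : Mˣ with ρ ∈ G j, if dc G i k (a * (ρ : M) * b) = D then 1 else 0 := by
  rw [NN_dc, Nat.card_eq_fintype_card, Fintype.card_subtype, Finset.card_filter,
    Finset.sum_filter]
  simp only [ite_and]

open Classical in
theorem sum_NN_mul [Finite M] [Fintype Mˣ] {G : ι → Subgroup Mˣ} {i j k : ι} (a b : M)
    (F : DC G i k → ℕ) : ∑ E, NN (dc G i j a) (dc G j k b) E * F E =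
      ∑ ρ : Mˣ with ρ ∈ G j, F (dc G i k (a * (ρ : M) * b)) := by
  simp only [NN_dc_sum, Finset.sum_mul]
  rw [Finset.sum_comm]
  refine Finset.sum_congr rfl fun ρ _ => ?_
  simp

theorem NN_assoc [Finite M] {G : ι → Subgroup Mˣ} {i j k l : ι} (A : DC G i j) (B : DC G j k)
    (C : DC G k l) (D : DC G i l) :
    ∑ E, NN A B E * NN E C D = ∑ F, NN B C F * NN A F D := by
  classical
  have := Fintype.ofFinite Mˣ
  obtain ⟨a, rfl⟩ := dc_surj A
  obtain ⟨b, rfl⟩ := dc_surj B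
  obtain ⟨c, rfl⟩ := dc_surj C
  rw [sum_NN_mul a b (fun E => NN E _ D), sum_NN_mul b c (fun F => NN _ F D)]
  simp only [NN_dc_sum]
  rw [Finset.sum_comm]
  simp only [mul_assoc]

theorem nL_pos [Finite M] {G : ι → Subgroup Mˣ} {i j : ι} (D : DC G i j) : 0 < nL D := by
  obtain ⟨a, rfl⟩ := dc_surj D
  rw [nL_dc]
  exact Nat.card_pos

theorem card_mul_dvd_sum {K : Type*} [Group K] [Fintype K] (H : Subgroup K) (m : ℕ) (v : K → ℕ)
    (hv : ∀ h ∈ H, ∀ x, v (h * x) = v x) (hm : ∀ x, m ∣ v x) : m * Nat.card H ∣ ∑ x, v x := by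
  classical
  have h2 : ∀ x y : K, (x : K ⧸ H) = y → v x⁻¹ = v y⁻¹ := by
    intro x y hxy
    rw [QuotientGroup.eq] at hxy
    rw [← hv _ hxy y⁻¹]
    congr 1
    group
  have h1 : ∑ x, v x = ∑ x : K, (fun q : K ⧸ H => v (q.out)⁻¹) (QuotientGroup.mk x) := by
    rw [← Equiv.sum_comp (Equiv.inv K) v]
    refine Finset.sum_congr rfl fun x _ => ?_
    exact h2 _ _ (by simp)
  rw [h1, ← Finset.sum_fiberwise' Finset.univ (fun x : K => (QuotientGroup.mk x : K ⧸ H))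
    (fun q : K ⧸ H => v (q.out)⁻¹)]
  refine Finset.dvd_sum fun q _ => ?_
  rw [Finset.sum_const, smul_eq_mul, mul_comm]
  refine mul_dvd_mul (dvd_of_eq ?_) (hm _)
  have := QuotientGroup.card_preimage_mk H {q}
  have hq : Nat.card ({q} : Set (K ⧸ H)) = 1 := Nat.card_unique
  rw [hq, mul_one] at this
  rw [← this, Nat.card_eq_fintype_card, ← Set.toFinset_card]
  congr 1
  ext x
  simp

theorem nL_mul_nL_dvd [Finite M] {G : ι → Subgroup Mˣ} {i j k : ι} (D₁ : DC G i j)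
    (D₂ : DC G j k) (D : DC G i k) : nL D₁ * nL D₂ ∣ nL D * NN D₁ D₂ D := by
  classical
  have := Fintype.ofFinite Mˣ
  obtain ⟨a, rfl⟩ := dc_surj D₁
  obtain ⟨b, rfl⟩ := dc_surj D₂
  obtain ⟨d, rfl⟩ := dc_surj D
  let P : Mˣ → Mˣ → Prop := fun ρ π => ∃ σ ∈ G i, a * (ρ : M) * b * (π : M) = (σ : M) * d
  let w : Mˣ → Mˣ → ℕ := fun π ρ => if ρ ∈ G j ∧ π ∈ G k ∧ P ρ π then 1 else 0
  have hsum : nL (dc G i k d) * NN (dc G i j a) (dc G j k b) (dc G i k d) = ∑ π, ∑ ρ, w π ρ := by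
    rw [Finset.sum_comm, NN_dc_sum, Finset.mul_sum, Finset.sum_filter]
    refine Finset.sum_congr rfl fun ρ _ => ?_
    by_cases hρ : ρ ∈ G j
    · by_cases hD : dc G i k (a * (ρ : M) * b) = dc G i k d
      · simp only [hρ, hD, if_true, mul_one, w, true_and]
        obtain ⟨σ, hσ, π, hπ, e⟩ := dc_eq_iff.1 hD
        rw [← Finset.card_filter, nL_dc, Nat.card_eq_fintype_card, Fintype.card_subtype]
        have e' : a * (ρ : M) * b = (σ⁻¹ : Mˣ) * d * (π⁻¹ : Mˣ) := by
          rw [← e]; simp [mul_assoc]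
        refine Finset.card_bij (fun x _ => π * x) ?_ (by simp) ?_
        · intro x hx
          simp only [Finset.mem_filter, Finset.mem_univ, true_and, mem_stabL] at hx ⊢
          obtain ⟨hx, τ, hτ, ex⟩ := hx
          refine ⟨mul_mem hπ hx, σ⁻¹ * τ, mul_mem (inv_mem hσ) hτ, ?_⟩
          rw [e']
          simp [mul_assoc, ex]
        · intro y hy
          simp only [Finset.mem_filter, Finset.mem_univ, true_and] at hy
          obtain ⟨hy, τ, hτ, ey⟩ := hy
          refine ⟨π⁻¹ * y, ?_, by simp⟩
          simp only [Finset.mem_filter, Finset.mem_univ, true_and, mem_stabL]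
          refine ⟨mul_mem (inv_mem hπ) hy, σ * τ, mul_mem hσ hτ, ?_⟩
          rw [e'] at ey
          rw [Units.val_mul, Units.val_mul, mul_assoc (σ : M), ← ey]
          simp [mul_assoc]
      · simp only [hρ, hD, if_true, if_false, mul_zero, w, true_and]
        symm
        refine Finset.sum_eq_zero fun π _ => if_neg ?_
        rintro ⟨hπ, σ, hσ, e⟩
        refine hD (dc_eq_iff.2 ⟨σ⁻¹, inv_mem hσ, π, hπ, ?_⟩)
        rw [mul_assoc, mul_assoc, Units.inv_mul_eq_iff_eq_mul, ← e]
        simp [mul_assoc]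
    · simp [hρ, w]
  rw [hsum]
  refine card_mul_dvd_sum (stabL G j k b) _ _ ?_ ?_
  · rintro h ⟨hk, τ, hτ, e⟩ π
    refine Fintype.sum_equiv (Equiv.mulRight τ) _ _ fun ρ => ?_
    have h1 : h * π ∈ G k ↔ π ∈ G k := Subgroup.mul_mem_cancel_left _ hk
    have h2 : ρ * τ ∈ G j ↔ ρ ∈ G j := Subgroup.mul_mem_cancel_right _ hτ
    have h3 : P ρ (h * π) ↔ P (ρ * τ) π := by
      have : a * (ρ : M) * b * ((h * π : Mˣ) : M) = a * ((ρ * τ : Mˣ) : M) * b * (π : M) := by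
        simp only [Units.val_mul, mul_assoc]
        rw [← mul_assoc b, e, mul_assoc]
      simp only [P, this]
    simp only [w, Equiv.coe_mulRight, h1, h2, h3]
  · intro π
    have := card_mul_dvd_sum (stabL G i j a) 1 (fun ρ => w π ρ) ?_ (fun _ => one_dvd _)
    · rwa [one_mul] at this
    · rintro h ⟨hj, τ, hτ, e⟩ ρ
      have h1 : h * ρ ∈ G j ↔ ρ ∈ G j := Subgroup.mul_mem_cancel_left _ hj
      have h3 : P (h * ρ) π ↔ P ρ π := by
        have : a * ((h * ρ : Mˣ) : M) * b * (π : M) = (τ : M) * (a * (ρ : M) * b * (π : M)) := by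
          simp only [Units.val_mul, ← mul_assoc]
          rw [e]
        constructor
        · rintro ⟨σ, hσ, e'⟩
          refine ⟨τ⁻¹ * σ, mul_mem (inv_mem hτ) hσ, ?_⟩
          rw [this] at e'
          rw [Units.val_mul, mul_assoc (τ⁻¹ : Mˣ).val, ← e']
          simp
        · rintro ⟨σ, hσ, e'⟩
          refine ⟨τ * σ, mul_mem hτ hσ, ?_⟩
          rw [this, e', Units.val_mul, mul_assoc]
      simp only [w, h1, h3]

theorem coef_cast [Finite M] {G : ι → Subgroup Mˣ} {i j k : ι} (D₁ : DC G i j)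
    (D₂ : DC G j k) (D : DC G i k) :
    (coef D₁ D₂ D : ℚ) = nL D * NN D₁ D₂ D / (nL D₁ * nL D₂) := by
  rw [coef, Nat.cast_div (nL_mul_nL_dvd D₁ D₂ D)]
  · push_cast; rfl
  · have := (nL_pos D₁).ne'
    have := (nL_pos D₂).ne'
    positivity

theorem coef_assoc [Finite M] {G : ι → Subgroup Mˣ} {i j k l : ι} (A : DC G i j) (B : DC G j k)
    (C : DC G k l) (D : DC G i l) :
    ∑ E, coef A B E * coef E C D = ∑ F, coef B C F * coef A F D := by
  have h : ∀ {i j} (D : DC G i j), (nL D : ℚ) ≠ 0 := fun D => by exact_mod_cast (nL_pos D).ne'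
  have key := congrArg (fun z : ℕ => (z : ℚ) * (nL D / (nL A * nL B * nL C))) (NN_assoc A B C D)
  have : ((∑ E, coef A B E * coef E C D : ℕ) : ℚ) = (∑ F, coef B C F * coef A F D : ℕ) := by
    push_cast at key ⊢
    rw [Finset.sum_mul, Finset.sum_mul] at key
    refine Eq.trans (Finset.sum_congr rfl fun E _ => ?_)
      (key.trans (Finset.sum_congr rfl fun E _ => ?_))
    · rw [coef_cast, coef_cast]
      have := h A; have := h B; have := h C; have := h E
      field_simp
    · rw [coef_cast, coef_cast]
      have := h A; have := h B; have := h C; have := h E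
      field_simp
  exact_mod_cast this

open Classical in
theorem coef_one_left [Finite M] {G : ι → Subgroup Mˣ} {i k : ι} (B D : DC G i k) :
    coef (dc G i i 1) B D = if B = D then 1 else 0 := by
  obtain ⟨b, rfl⟩ := dc_surj B
  have h1 : nL (dc G i i (1 : M)) = Nat.card (G i) := by
    rw [nL_dc]
    congr
    ext π
    rw [mem_stabL]
    exact ⟨fun h => h.1, fun h => ⟨h, π, h, by simp⟩⟩
  have h2 : NN (dc G i i (1 : M)) (dc G i k b) D =
      if dc G i k b = D then Nat.card (G i) else 0 := by
    have : ∀ ρ ∈ G i, dc G i k (1 * (ρ : M) * b) = dc G i k b := fun ρ hρ => by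
      simpa using dc_mul_mul hρ (one_mem (G k)) b
    rw [NN_dc]
    split_ifs with h
    · exact Nat.card_congr (Equiv.subtypeEquivRight fun ρ =>
        ⟨fun h' => h'.1, fun h' => ⟨h', (this ρ h').trans h⟩⟩)
    · have : IsEmpty {ρ : Mˣ // ρ ∈ G i ∧ dc G i k (1 * (ρ : M) * b) = D} :=
        ⟨fun x => h ((this x.1 x.2.1).symm.trans x.2.2)⟩
      exact Nat.card_of_isEmpty
  rw [coef, h1, h2]
  split_ifs with h
  · subst h
    rw [mul_comm]
    exact Nat.div_self (Nat.mul_pos Nat.card_pos (nL_pos _))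
  · simp

open Classical in
theorem coef_one_right [Finite M] {G : ι → Subgroup Mˣ} {i k : ι} (A D : DC G i k) :
    coef A (dc G k k 1) D = if A = D then 1 else 0 := by
  obtain ⟨a, rfl⟩ := dc_surj A
  have h1 : nL (dc G k k (1 : M)) = Nat.card (G k) := by
    rw [nL_dc]
    congr
    ext π
    rw [mem_stabL]
    exact ⟨fun h => h.1, fun h => ⟨h, π, h, by simp⟩⟩
  have h2 : NN (dc G i k a) (dc G k k (1 : M)) D =
      if dc G i k a = D then Nat.card (G k) else 0 := by
    have : ∀ ρ ∈ G k, dc G i k (a * (ρ : M) * 1) = dc G i k a := fun ρ hρ => by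
      simpa using dc_mul_mul (one_mem (G i)) hρ a
    rw [NN_dc]
    split_ifs with h
    · exact Nat.card_congr (Equiv.subtypeEquivRight fun ρ =>
        ⟨fun h' => h'.1, fun h' => ⟨h', (this ρ h').trans h⟩⟩)
    · have : IsEmpty {ρ : Mˣ // ρ ∈ G k ∧ dc G i k (a * (ρ : M) * 1) = D} :=
        ⟨fun x => h ((this x.1 x.2.1).symm.trans x.2.2)⟩
      exact Nat.card_of_isEmpty
  rw [coef, h1, h2]
  split_ifs with h
  · subst h
    exact Nat.div_self (Nat.mul_pos (nL_pos _) Nat.card_pos)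
  · simp

/-- The left algebra over `R` attached to the finite monoid `M` and the family `G` of subgroups:
the free `R`-module with one basis element `f(i, D, j)` for each pair `i, j` and each double coset
`D` of `G i` and `G j`, an element being given by its coefficients. For `R = ℤ` this is the left
`ℤ`-form, and in general it is the base change of the left `ℤ`-form to `R`: the structure constants
are the images in `R` of those over `ℤ`. -/
@[ext]
structure LAlg (R : Type*) (G : ι → Subgroup Mˣ) where
  /-- The coefficient of `f(i, D, j)`. -/
  coeff : ∀ i j, DC G i j → R

namespace LAlg

section Module

theorem ext' {R : Type*} {G : ι → Subgroup Mˣ} {a b : LAlg R G}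
    (h : ∀ i j D, a.coeff i j D = b.coeff i j D) : a = b :=
  LAlg.ext (funext fun i => funext fun j => funext fun D => h i j D)

variable {R : Type*} [CommRing R] {G : ι → Subgroup Mˣ}

noncomputable instance instAdd : Add (LAlg R G) :=
  ⟨fun a b => ⟨fun i j D => a.coeff i j D + b.coeff i j D⟩⟩

noncomputable instance instZero : Zero (LAlg R G) := ⟨⟨fun _ _ _ => 0⟩⟩

noncomputable instance instNeg : Neg (LAlg R G) := ⟨fun a => ⟨fun i j D => -a.coeff i j D⟩⟩

noncomputable instance instAddCommGroup : AddCommGroup (LAlg R G) where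
  nsmul := nsmulRec
  zsmul := zsmulRec
  add_assoc _ _ _ := ext' fun _ _ _ => add_assoc _ _ _
  zero_add _ := ext' fun _ _ _ => zero_add _
  add_zero _ := ext' fun _ _ _ => add_zero _
  add_comm _ _ := ext' fun _ _ _ => add_comm _ _
  neg_add_cancel _ := ext' fun _ _ _ => neg_add_cancel _

noncomputable instance instModule : Module R (LAlg R G) where
  smul c a := ⟨fun i j D => c * a.coeff i j D⟩
  one_smul _ := ext' fun _ _ _ => one_mul _
  mul_smul _ _ _ := ext' fun _ _ _ => mul_assoc _ _ _
  smul_zero _ := ext' fun _ _ _ => mul_zero _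
  smul_add _ _ _ := ext' fun _ _ _ => mul_add _ _ _
  add_smul _ _ _ := ext' fun _ _ _ => add_mul _ _ _
  zero_smul _ := ext' fun _ _ _ => zero_mul _

theorem add_coeff (a b : LAlg R G) (i j : ι) (D : DC G i j) :
    (a + b).coeff i j D = a.coeff i j D + b.coeff i j D := rfl

theorem zero_coeff (i j : ι) (D : DC G i j) : (0 : LAlg R G).coeff i j D = 0 := rfl

theorem smul_coeff (c : R) (a : LAlg R G) (i j : ι) (D : DC G i j) :
    (c • a).coeff i j D = c * a.coeff i j D := rfl

open Classical in
/-- The basis element `f(i, D, j)`. -/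
noncomputable def f (R : Type*) [CommRing R] {G : ι → Subgroup Mˣ} (i : ι) (j : ι) (D : DC G i j) :
    LAlg R G where
  coeff := Pi.single (M := fun i => ∀ j, DC G i j → R) i
    (Pi.single (M := fun j => DC G i j → R) j (Pi.single D 1))

open Classical in
theorem f_coeff (i j : ι) (D : DC G i j) (i' j' : ι) (D' : DC G i' j') :
    (f R i j D).coeff i' j' D' =
      if (⟨(i, j), D⟩ : Σ q : ι × ι, DC G q.1 q.2) = ⟨(i', j'), D'⟩ then 1 else 0 := by
  simp only [f]
  by_cases hi : i' = i
  · subst hi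
    rw [Pi.single_eq_same]
    by_cases hj : j' = j
    · subst hj
      rw [Pi.single_eq_same, Pi.single_apply]
      simp [eq_comm]
    · rw [Pi.single_eq_of_ne hj, if_neg]
      · rfl
      · intro h
        simp only [Sigma.mk.injEq, Prod.mk.injEq] at h
        exact hj h.1.2.symm
  · rw [Pi.single_eq_of_ne hi, if_neg]
    · rfl
    · intro h
      simp only [Sigma.mk.injEq, Prod.mk.injEq] at h
      exact hi h.1.1.symm

end Module

section Ring

variable {R : Type*} [CommRing R] {G : ι → Subgroup Mˣ} [Fintype ι] [Finite M]

/-- The product: `f(i, D₁, j) * f(j', D₂, k) = 0` for `j ≠ j'`, and `f(i, D₁, j) * f(j, D₂, k)` is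
the sum over all `D` of `n_L(D) N(D₁, D₂, D) / (n_L(D₁) n_L(D₂)) • f(i, D, k)`. -/
noncomputable instance : Mul (LAlg R G) where
  mul a b := ⟨fun i k D => ∑ j, ∑ D₁ : DC G i j, ∑ D₂ : DC G j k,
    (coef D₁ D₂ D : R) * (a.coeff i j D₁ * b.coeff j k D₂)⟩

theorem mul_coeff (a b : LAlg R G) (i k : ι) (D : DC G i k) :
    (a * b).coeff i k D = ∑ j, ∑ D₁ : DC G i j, ∑ D₂ : DC G j k,
      (coef D₁ D₂ D : R) * (a.coeff i j D₁ * b.coeff j k D₂) := rfl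

open Classical in
/-- The element `∑ i, e i • f(i, G i, i)`. -/
noncomputable def diag (e : ι → R) : LAlg R G where
  coeff i j D := if i = j ∧ D = dc G i j 1 then e i else 0

/-- The unit element is the sum of all `f(i, G i, i)`. -/
noncomputable instance : One (LAlg R G) where
  one := diag fun _ => 1

theorem diag_mul_coeff (e : ι → R) (b : LAlg R G) (i k : ι) (D : DC G i k) :
    (diag e * b).coeff i k D = e i * b.coeff i k D := by
  classical
  rw [mul_coeff, Finset.sum_eq_single i, Finset.sum_eq_single (dc G i i 1)]
  · simp [coef_one_left, diag]
  · intro D₁ _ h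
    simp [diag, h]
  · simp
  · intro j _ h
    simp [diag, Ne.symm h]
  · simp

theorem mul_diag_coeff (e : ι → R) (b : LAlg R G) (i k : ι) (D : DC G i k) :
    (b * diag e).coeff i k D = b.coeff i k D * e k := by
  classical
  rw [mul_coeff, Finset.sum_eq_single k, Finset.sum_comm, Finset.sum_eq_single (dc G k k 1)]
  · simp [coef_one_right, diag]
  · intro D₁ _ h
    simp [diag, h]
  · simp
  · intro j _ h
    simp [diag, h]
  · simp

theorem sum_rot {α β γ : Type*} [Fintype α] [Fintype β] [Fintype γ] (h : α → β → γ → R) :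
    ∑ x, ∑ y, ∑ z, h x y z = ∑ z, ∑ x, ∑ y, h x y z := by
  rw [Finset.sum_congr rfl fun x _ => Finset.sum_comm, Finset.sum_comm]

theorem mul_assoc' (a b c : LAlg R G) : a * b * c = a * (b * c) := by
  refine ext' fun i l D => ?_
  have hL : (a * b * c).coeff i l D = ∑ j, ∑ k, ∑ A : DC G i j, ∑ B : DC G j k, ∑ C : DC G k l,
      ((∑ E, coef A B E * coef E C D : ℕ) : R) *
        (a.coeff i j A * b.coeff j k B * c.coeff k l C) := by
    simp only [mul_coeff, Finset.sum_mul, Finset.mul_sum, Nat.cast_sum, Nat.cast_mul]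
    rw [Finset.sum_comm (γ := ι)]
    refine Finset.sum_congr rfl fun k _ => ?_
    rw [sum_rot]
    refine Finset.sum_congr rfl fun j _ => ?_
    rw [sum_rot]
    refine Finset.sum_congr rfl fun A _ => ?_
    rw [sum_rot]
    refine Finset.sum_congr rfl fun B _ => ?_
    rw [Finset.sum_comm]
    refine Finset.sum_congr rfl fun C _ => Finset.sum_congr rfl fun E _ => ?_
    ring
  have hR : (a * (b * c)).coeff i l D = ∑ j, ∑ k, ∑ A : DC G i j, ∑ B : DC G j k, ∑ C : DC G k l,
      ((∑ F, coef B C F * coef A F D : ℕ) : R) *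
        (a.coeff i j A * b.coeff j k B * c.coeff k l C) := by
    simp only [mul_coeff, Finset.sum_mul, Finset.mul_sum, Nat.cast_sum, Nat.cast_mul]
    refine Finset.sum_congr rfl fun j _ => ?_
    rw [sum_rot]
    refine Finset.sum_congr rfl fun k _ => Finset.sum_congr rfl fun A _ => ?_
    rw [sum_rot fun B C F => (coef B C F : R) * (coef A F D : R) *
        (a.coeff i j A * b.coeff j k B * c.coeff k l C)]
    refine Finset.sum_congr rfl fun F _ => Finset.sum_congr rfl fun B _ =>
      Finset.sum_congr rfl fun C _ => ?_
    ring
  simp only [hL, hR, coef_assoc]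

noncomputable instance : Ring (LAlg R G) where
  __ := instAddCommGroup
  left_distrib a b c := ext' fun i k D => by
    simp only [mul_coeff, add_coeff, mul_add, Finset.sum_add_distrib]
  right_distrib a b c := ext' fun i k D => by
    simp only [mul_coeff, add_coeff, mul_add, add_mul, Finset.sum_add_distrib]
  zero_mul a := ext' fun i k D => by simp [mul_coeff, zero_coeff]
  mul_zero a := ext' fun i k D => by simp [mul_coeff, zero_coeff]
  mul_assoc := mul_assoc'
  one_mul a := ext' fun i k D => (diag_mul_coeff _ a i k D).trans (one_mul _)
  mul_one a := ext' fun i k D => (mul_diag_coeff _ a i k D).trans (mul_one _)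

noncomputable instance : Algebra R (LAlg R G) :=
  Algebra.ofModule
    (fun r a b => ext' fun i k D => by
      simp only [mul_coeff, smul_coeff, Finset.mul_sum]
      refine Finset.sum_congr rfl fun _ _ => Finset.sum_congr rfl fun _ _ =>
        Finset.sum_congr rfl fun _ _ => by ring)
    (fun r a b => ext' fun i k D => by
      simp only [mul_coeff, smul_coeff, Finset.mul_sum]
      refine Finset.sum_congr rfl fun _ _ => Finset.sum_congr rfl fun _ _ =>
        Finset.sum_congr rfl fun _ _ => by ring)

/-- The element `1_i = f(i, G i, i)`. -/
noncomputable def idem (R : Type*) [CommRing R] (G : ι → Subgroup Mˣ) (i : ι) : LAlg R G :=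
  f R i i (dc G i i 1)

open Classical in
theorem idem_eq_diag (i : ι) : idem R G i = diag (Pi.single i 1) := by
  refine ext' fun a b D => ?_
  rw [idem, f_coeff]
  simp only [diag]
  by_cases ha : a = i
  · subst ha
    by_cases hb : a = b
    · subst hb
      simp [eq_comm]
    · simp [hb]
  · simp [ha, Ne.symm ha]

theorem isIdempotentElem_idem (i : ι) : IsIdempotentElem (idem R G i) := by
  classical
  refine ext' fun a b D => ?_
  nth_rw 1 [idem_eq_diag]
  rw [diag_mul_coeff]
  by_cases ha : a = i
  · subst ha; simp
  · simp [ha, idem_eq_diag, diag]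

theorem f_mem_corner (i : ι) (D : DC G i i) : f R i i D ∈ Subsemigroup.corner (idem R G i) := by
  classical
  rw [Subsemigroup.mem_corner_iff (isIdempotentElem_idem i), idem_eq_diag]
  constructor
  · refine ext' fun a b D' => ?_
    rw [diag_mul_coeff]
    by_cases ha : a = i
    · subst ha; simp
    · rw [f_coeff, if_neg]
      · simp
      · intro h
        simp only [Sigma.mk.injEq, Prod.mk.injEq] at h
        exact ha h.1.1.symm
  · refine ext' fun a b D' => ?_
    rw [mul_diag_coeff]
    by_cases hb : b = i
    · subst hb; simp
    · rw [f_coeff, if_neg]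
      · simp
      · intro h
        simp only [Sigma.mk.injEq, Prod.mk.injEq] at h
        exact hb h.1.2.symm

end Ring

end LAlg

end DoubleCosetAlgebra

section Transformations

/-- The monoid of all maps `α : {0, …, r} → {0, …, r}` with `α 0 = 0`, under composition. -/
def tauBar (r : ℕ) : Submonoid (Function.End (Fin (r + 1))) where
  carrier := {α | α 0 = 0}
  one_mem' := rfl
  mul_mem' := fun {α β} (hα : α 0 = 0) (hβ : β 0 = 0) => show α (β 0) = 0 by rw [hβ, hα]

/-- The full transformation monoid of `{1, …, r}`, each map being extended by `0 ↦ 0`. -/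
def tau (r : ℕ) : Submonoid (Function.End (Fin (r + 1))) where
  carrier := {α | α 0 = 0 ∧ ∀ j, α j = 0 → j = 0}
  one_mem' := ⟨rfl, fun _ h => h⟩
  mul_mem' := fun {α β} hα hβ =>
    ⟨show α (β 0) = 0 by rw [hβ.1, hα.1], fun j h => hβ.2 j (hα.2 (β j) h)⟩

/-- The rook monoid: each `i ≠ 0` has at most one preimage. -/
def rook (r : ℕ) : Submonoid (Function.End (Fin (r + 1))) where
  carrier := {α | α 0 = 0 ∧ ∀ i, i ≠ 0 → ∀ j j', α j = i → α j' = i → j = j'}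
  one_mem' := ⟨rfl, fun _ _ _ _ h h' => h.trans h'.symm⟩
  mul_mem' := fun {α β} hα hβ =>
    ⟨show α (β 0) = 0 by rw [hβ.1, hα.1], fun i hi j j' h h' => by
      have e : β j = β j' := hα.2 i hi _ _ h h'
      refine hβ.2 (β j) (fun h0 => hi ?_) j j' rfl e.symm
      rw [← h]
      change α (β j) = 0
      rw [h0, hα.1]⟩

/-- The symmetric group on `{1, …, r}`, each permutation being extended by `0 ↦ 0`. -/
def sym (r : ℕ) : Submonoid (Function.End (Fin (r + 1))) where
  carrier := {α | α 0 = 0 ∧ Function.Bijective α}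
  one_mem' := ⟨rfl, Function.bijective_id⟩
  mul_mem' := fun {α β} hα hβ =>
    ⟨show α (β 0) = 0 by rw [hβ.1, hα.1], hα.2.comp hβ.2⟩

instance (r : ℕ) : Finite (Function.End (Fin (r + 1))) :=
  inferInstanceAs (Finite (Fin (r + 1) → Fin (r + 1)))

/-- The compositions of `r` with `n` parts (zero parts are allowed). -/
def Compos (r n : ℕ) : Type := {l : Fin n → ℕ // ∑ i, l i = r}

namespace Compos

variable {r n : ℕ}

instance : Fintype (Compos r n) :=
  Fintype.subtype (Finset.Nat.antidiagonalTuple n r) fun _ => Finset.Nat.mem_antidiagonalTuple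

/-- The `i`-th block `{x : l_1 + ⋯ + l_{i-1} < x ≤ l_1 + ⋯ + l_i}`. -/
def block (l : Compos r n) (i : Fin n) : Set (Fin (r + 1)) :=
  {x | ∑ j ∈ Finset.Iio i, l.1 j < (x : ℕ) ∧ (x : ℕ) ≤ ∑ j ∈ Finset.Iic i, l.1 j}

/-- `l` is a partition: its parts are in decreasing order. -/
def IsPartition (l : Compos r n) : Prop := Antitone l.1

/-- The partition obtained from `l` by arranging its parts in decreasing order. -/
def plus (l : Compos r n) : Fin n → ℕ := fun i => (l.1 ∘ Tuple.sort l.1) (Fin.rev i)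

/-- `l < m` for compositions: the partition of `l` is lexicographically smaller than that of `m`. -/
def Below (l m : Compos r n) : Prop :=
  ∃ k, (∀ i < k, l.plus i = m.plus i) ∧ l.plus k < m.plus k

/-- Each nonzero part of `l` is a power of `p`. -/
def IsPPowers (p : ℕ) (l : Compos r n) : Prop := ∀ i, l.1 i = 0 ∨ ∃ e : ℕ, l.1 i = p ^ e

/-- `s_i`, the number of parts equal to `p ^ i`. -/
def mult (p : ℕ) (l : Compos r n) (i : ℕ) : ℕ := (Finset.univ.filter fun j => l.1 j = p ^ i).card

/-- The number of integers in the blocks of size larger than `p ^ i`. -/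
def offset (p : ℕ) (l : Compos r n) (i : ℕ) : ℕ :=
  ∑ j ∈ Finset.univ.filter (fun j => p ^ i < l.1 j), l.1 j

/-- The Young subgroup of `l`, as a group of units of the monoid `S` of maps: those `u` which map
each block to itself. (For `sym r ≤ S ≤ tauBar r` the units of `S` are exactly the elements
of `sym r`.) -/
def young (S : Submonoid (Function.End (Fin (r + 1)))) (l : Compos r n) : Subgroup (S)ˣ where
  carrier := {u | ∀ i x, (u : S).1 x ∈ l.block i ↔ x ∈ l.block i}
  one_mem' := fun _ _ => Iff.rfl
  mul_mem' := fun {u v} hu hv i x => (hu i ((v : S).1 x)).trans (hv i x)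
  inv_mem' := fun {u} hu i x => by
    rw [← hu i]
    have : (u : S).1 ((u⁻¹ : (S)ˣ).1.1 x) = x :=
      congrFun (congrArg Subtype.val u.mul_inv) x
    rw [this]

/-- `IsPhi p l α β` says that `β` is the image under `φ_l` of the family `α`, `α i` being a map of
`{0, …, s_i}` to itself: `β 0 = 0`, and `β` maps the `b`-th element of the `a`-th block of size
`p ^ i` to the `b`-th element of the `α i a`-th block of size `p ^ i` if `α i a ≠ 0`, and to `0` if
`α i a = 0`. -/
def IsPhi (p : ℕ) (l : Compos r n) (α : ∀ i, Function.End (Fin (l.mult p i + 1)))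
    (β : Function.End (Fin (r + 1))) : Prop :=
  β 0 = 0 ∧ ∀ (i : ℕ) (a : Fin (l.mult p i + 1)) (b : ℕ) (x : Fin (r + 1)),
    a ≠ 0 → 1 ≤ b → b ≤ p ^ i → (x : ℕ) = l.offset p i + ((a : ℕ) - 1) * p ^ i + b →
      (β x : ℕ) = if α i a = 0 then 0 else l.offset p i + ((α i a : ℕ) - 1) * p ^ i + b

/-- `S_{r,L}^l`: the elements of `S` in the image under `φ_l` of the product of the monoid
`tauBar s_0` and the symmetric groups `sym s_i`, `i > 0`. -/
def leftMonoid (S : Submonoid (Function.End (Fin (r + 1)))) (p : ℕ) (l : Compos r n) :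
    Submonoid (Function.End (Fin (r + 1))) where
  carrier := {β | β ∈ S ∧ ∃ α : ∀ i, Function.End (Fin (l.mult p i + 1)),
    α 0 ∈ tauBar _ ∧ (∀ i, 0 < i → α i ∈ sym _) ∧ l.IsPhi p α β}
  one_mem' := by
    refine ⟨one_mem _, fun i => 1, one_mem _, fun _ _ => one_mem _, rfl, ?_⟩
    intro i a b x ha hb hb' hx
    change (x : ℕ) = if a = 0 then 0 else _
    rw [if_neg ha, hx]
    rfl
  mul_mem' := by
    rintro β β' ⟨hβ, α, h0, h1, h2, h3⟩ ⟨hβ', α', h0', h1', h2', h3'⟩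
    refine ⟨mul_mem hβ hβ', fun i => α i * α' i, mul_mem h0 h0',
      fun i hi => mul_mem (h1 i hi) (h1' i hi), ?_, ?_⟩
    · change β (β' 0) = 0
      rw [h2', h2]
    · intro i a b x ha hb hb' hx
      have e := h3' i a b x ha hb hb' hx
      change (β (β' x) : ℕ) = if α i (α' i a) = 0 then 0 else
        l.offset p i + ((α i (α' i a) : ℕ) - 1) * p ^ i + b
      by_cases h : α' i a = 0
      · have z : α i 0 = 0 := by
          rcases Nat.eq_zero_or_pos i with rfl | hi
          · exact h0
          · exact (h1 i hi).1
        rw [if_pos h] at e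
        rw [h, z, if_pos rfl, Fin.ext (a := β' x) (b := 0) e, h2]
        rfl
      · rw [if_neg h] at e
        exact h3 i (α' i a) b (β' x) h hb hb' e

end Compos

variable {r n : ℕ}

/-- The left generalized Schur algebra `B_L` over `k` of the monoid `S`. -/
abbrev LGS (k : Type*) (S : Submonoid (Function.End (Fin (r + 1)))) (n : ℕ) : Type _ :=
  LAlg k fun l : Compos r n => l.young S

variable (k : Type*) [Field k] (S : Submonoid (Function.End (Fin (r + 1)))) (l : Compos r n)

/-- The idempotent `1_l = f(l, 1, l)` of `B_L`. -/
noncomputable def oneAt : LGS k S n := LAlg.idem k (fun l : Compos r n => l.young S) l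

open Classical in
/-- `e_l`, the sum of all `1_m` with `m < l`. -/
noncomputable def eBelow : LGS k S n :=
  ∑ m ∈ Finset.univ.filter (fun m : Compos r n => m.Below l), oneAt k S m

theorem isIdempotentElem_oneAt : IsIdempotentElem (oneAt k S l) := LAlg.isIdempotentElem_idem _

/-- `B_L^l = 1_l B_L 1_l`, an algebra with unit `1_l`. -/
abbrev BL : Type _ := (isIdempotentElem_oneAt k S l).Corner

/-- The kernel `B_L e_l B_L ∩ B_L^l`. -/
noncomputable abbrev KL : Ideal (BL k S l) :=
  cornerIdeal (isIdempotentElem_oneAt k S l) (eBelow k S l)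

/-- `C_L^l = B_L^l / (B_L e_l B_L ∩ B_L^l)`. -/
abbrev CL : Type _ := BL k S l ⧸ KL k S l

/-- The natural projection `Π_L : B_L^l → C_L^l`. -/
noncomputable def projL : BL k S l →ₐ[k] CL k S l := Ideal.Quotient.mkₐ k (KL k S l)

/-- The element `f(l, α, l)` of `B_L^l`, for `α ∈ S`. -/
noncomputable def fAt (α : S) : BL k S l :=
  ⟨LAlg.f k l l (dc (fun l : Compos r n => l.young S) l l α), LAlg.f_mem_corner l _⟩

/-- The linear map `ψ_{l,L} : k[S_{r,L}^l] → B_L^l`, `α ↦ f(l, α, l)`. -/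
noncomputable def psiL (p : ℕ) : MonoidAlgebra k (l.leftMonoid S p) →ₗ[k] BL k S l :=
  (Finsupp.linearCombination k fun α : l.leftMonoid S p => fAt k S l ⟨α.1, α.2.1⟩) ∘ₗ
    (MonoidAlgebra.coeffLinearEquiv k).toLinearMap

end Transformations

end GSchur

open scoped TensorProduct

namespace GSchur

/-! ### Products and divisibility of structure constants in the double coset algebra. -/

section Generic

variable {M ι : Type*} [Monoid M]

/-! Write `G` for the Young subgroup of `l`, and call a block large if it has at least two points.
An element `β` of `leftMonoid` carries each block to a block or to `0`, and permutes the large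
blocks of each size. Hence `β π ∈ G β` for all `π ∈ G` (`leftMonoid_mul_young`): the double coset of
`β` is one left coset, `n_L = |G|`, and the product formula collapses to `f(α) f(β) = f(α β)`
(`fAt_mul`). Distinct elements lie in distinct double cosets (`leftMonoid_dc_inj`). It remains to
see that the `f(l, β, l)` form a basis of the corner modulo the ideal.

Spanning. Suppose the stabilizer of the left coset `G α` respects a proper part `Z` of a block, on
the target or on the source side. Splitting that block into `Z` and the rest gives a smaller
composition `m`, and `f(l, α, l)` is a product of two basis elements through `m`, with coefficient
one, so it lies in the ideal (`f_mem_span_of_target`, `f_mem_span_of_source`). If no such splitting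
applies, `α` maps each block onto a block or to `0` and permutes the points of the large blocks, and
then `G α G` meets `leftMonoid` (`f_mem_span_or_exists_leftMonoid`).

Independence. The coefficient at the double coset of `β ∈ leftMonoid` vanishes on the ideal. Since
`n_L = |G|` there, a structure constant through `m < l` with second factor `b` is a multiple of the
index in `G` of the stabilizer of `b` (`relIndex_dvd_coef`). If `p` does not divide it, that
stabilizer is transitive on the blocks of `l`, whose sizes are powers of `p`
(`exists_smul_eq_of_relIndex`). So `b` maps each large block into a single block of `m`, injectively
because `β` is injective there. Then for every `q` the blocks of size at least `q` cover at least as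
many points for `m` as for `l`, which contradicts `m < l` (`dvd_coef`).

The tensor decomposition is formal: all permutations lie in `S`, so whether `φ_l(α)` lies in `S`
depends only on `α 0`. This defines `S_0` and makes `leftMonoid` a direct product
(`mem_leftMonoid_iff`, `nonempty_leftMonoid_mulEquiv`). -/

theorem stabL_le {G : ι → Subgroup Mˣ} {i j : ι} {a : M} : stabL G i j a ≤ G j := fun _ h => h.1

theorem LAlg.f_mul_f_coeff {R : Type*} [CommRing R] {G : ι → Subgroup Mˣ} [Fintype ι] [Finite M]
    {i j k : ι} (D₁ : DC G i j) (D₂ : DC G j k) (D : DC G i k) :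
    (f R i j D₁ * f R j k D₂).coeff i k D = coef D₁ D₂ D := by
  classical
  rw [mul_coeff, Finset.sum_eq_single j, Finset.sum_eq_single D₁, Finset.sum_eq_single D₂]
  · simp [f_coeff]
  · intro E _ h
    simp [f_coeff, Ne.symm h]
  · simp
  · intro E _ h
    simp [f_coeff, Ne.symm h]
  · simp
  · intro j' _ h
    simp [f_coeff, Ne.symm h]
  · simp

/-- If `a ρ b` lies in the double coset of `a b` for all `ρ ∈ G j` and the orders of stabilizers
match, the product of the basis elements of `a` and `b` is the basis element of `a b`. -/
theorem LAlg.f_mul_f {R : Type*} [CommRing R] {G : ι → Subgroup Mˣ} [Fintype ι] [Finite M]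
    {i j k : ι} {a b : M} (h : ∀ ρ ∈ G j, dc G i k (a * (ρ : M) * b) = dc G i k (a * b))
    (hc : nL (dc G i k (a * b)) * Nat.card (G j) = nL (dc G i j a) * nL (dc G j k b)) :
    f R i j (dc G i j a) * f R j k (dc G j k b) = f R i k (dc G i k (a * b)) := by
  classical
  refine ext' fun i' k' D => ?_
  by_cases hi : i' = i
  · subst hi
    by_cases hk : k' = k
    · subst hk
      rw [f_mul_f_coeff, f_coeff]
      have hNN : NN (dc G i' j a) (dc G j k' b) D =
          if dc G i' k' (a * b) = D then Nat.card (G j) else 0 := by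
        rw [NN_dc]
        split_ifs with h'
        · exact Nat.card_congr (Equiv.subtypeEquivRight fun ρ =>
            ⟨fun x => x.1, fun x => ⟨x, (h ρ x).trans h'⟩⟩)
        · have : IsEmpty {ρ : Mˣ // ρ ∈ G j ∧ dc G i' k' (a * (ρ : M) * b) = D} :=
            ⟨fun x => h' ((h x.1 x.2.1).symm.trans x.2.2)⟩
          exact Nat.card_of_isEmpty
      rw [coef, hNN]
      by_cases h' : dc G i' k' (a * b) = D
      · subst h'
        rw [if_pos rfl, hc, Nat.div_self (Nat.mul_pos (nL_pos _) (nL_pos _))]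
        simp
      · rw [if_neg h', if_neg]
        · simp
        · simpa using h'
    · rw [mul_coeff, f_coeff, if_neg]
      · refine Finset.sum_eq_zero fun x _ => Finset.sum_eq_zero fun y _ =>
          Finset.sum_eq_zero fun z _ => ?_
        rw [f_coeff j k, if_neg]
        · simp
        · intro h
          simp only [Sigma.mk.injEq, Prod.mk.injEq] at h
          exact hk h.1.2.symm
      · intro h
        simp only [Sigma.mk.injEq, Prod.mk.injEq] at h
        exact hk h.1.2.symm
  · rw [mul_coeff, f_coeff, if_neg]
    · refine Finset.sum_eq_zero fun x _ => Finset.sum_eq_zero fun y _ =>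
        Finset.sum_eq_zero fun z _ => ?_
      rw [f_coeff i j, if_neg]
      · simp
      · intro h
        simp only [Sigma.mk.injEq, Prod.mk.injEq] at h
        exact hi h.1.1.symm
    · intro h
      simp only [Sigma.mk.injEq, Prod.mk.injEq] at h
      exact hi h.1.1.symm

/-- For `h` in the stabilizer of the left coset of `a` one has `a h ρ b = τ a ρ b` with `τ ∈ G i`.
So the set counted by `N` is a union of cosets of that stabilizer. -/
theorem nL_dc_dvd_NN [Finite M] {G : ι → Subgroup Mˣ} {i j k : ι} (a b : M) (D : DC G i k) :
    nL (dc G i j a) ∣ NN (dc G i j a) (dc G j k b) D := by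
  classical
  have := Fintype.ofFinite Mˣ
  rw [NN_dc_sum, nL_dc, ← one_mul (Nat.card _), Finset.sum_filter]
  refine card_mul_dvd_sum _ 1 _ ?_ fun _ => one_dvd _
  rintro h ⟨hj, τ, hτ, e⟩ ρ
  have h1 : h * ρ ∈ G j ↔ ρ ∈ G j := Subgroup.mul_mem_cancel_left _ hj
  have h2 : dc G i k (a * ((h * ρ : Mˣ) : M) * b) = dc G i k (a * (ρ : M) * b) := by
    rw [← dc_mul_mul hτ (one_mem (G k)) (a * (ρ : M) * b)]
    simp only [Units.val_mul, ← mul_assoc, e, Units.val_one, mul_one]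
  simp only [h1, h2]

/-- If the left coset of `d` is invariant under `G k`, the structure constants at the double coset
of `d` are divisible by the number of left cosets in the second factor. -/
theorem relIndex_dvd_coef [Finite M] {G : ι → Subgroup Mˣ} {i j k : ι} (D₁ : DC G i j) (b : M)
    (D : DC G i k) (hd : nL D = Nat.card (G k)) :
    (stabL G j k b).relIndex (G k) ∣ coef D₁ (dc G j k b) D := by
  obtain ⟨a, rfl⟩ := dc_surj D₁
  obtain ⟨m, hm⟩ := nL_dc_dvd_NN a b D
  -- With `n_L(D) = |G k|` the factor `n_L(D₂)` cancels against `|G k|` and leaves the index;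
  -- `n_L(D₁)` cancels against `N`.
  have hi : (stabL G j k b).relIndex (G k) * nL (dc G j k b) = Nat.card (G k) := by
    rw [nL_dc, mul_comm, ← Subgroup.relIndex_bot_left, ← Subgroup.relIndex_bot_left,
      Subgroup.relIndex_mul_relIndex _ _ _ bot_le stabL_le]
  rw [coef, hm, hd, ← hi]
  refine ⟨m, ?_⟩
  have h1 := nL_pos (dc G i j a)
  have h2 := nL_pos (dc G j k b)
  refine Nat.div_eq_of_eq_mul_right (Nat.mul_pos h1 h2) ?_
  ring

/-- Only products through indices `j` with `e j ≠ 0` contribute. Applied with `e = e_l`, this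
reduces the vanishing on the ideal to structure constants through smaller compositions. -/
theorem LAlg.mul_diag_mul_coeff_eq_zero {R : Type*} [CommRing R] {G : ι → Subgroup Mˣ} [Fintype ι]
    [Finite M] (e : ι → R) (x y : LAlg R G) (i k : ι) (D : DC G i k)
    (h : ∀ j (D₁ : DC G i j) (D₂ : DC G j k), e j ≠ 0 → (coef D₁ D₂ D : R) = 0) :
    (x * diag e * y).coeff i k D = 0 := by
  rw [mul_assoc, mul_coeff]
  refine Finset.sum_eq_zero fun j _ => Finset.sum_eq_zero fun D₁ _ =>
    Finset.sum_eq_zero fun D₂ _ => ?_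
  rw [diag_mul_coeff]
  by_cases he : e j = 0
  · simp [he]
  · simp [h j D₁ D₂ he]

end Generic

/-! ### Blocks as colourings, and the order on compositions. -/

namespace Compos

variable {r n : ℕ}

theorem sum_Iic_eq (l : Compos r n) (i : Fin n) :
    ∑ j ∈ Finset.Iic i, l.1 j = ∑ j ∈ Finset.Iio i, l.1 j + l.1 i := by
  rw [← Finset.Iio_insert, Finset.sum_insert (by simp), add_comm]

theorem sum_Iic_le (l : Compos r n) (i : Fin n) : ∑ j ∈ Finset.Iic i, l.1 j ≤ r := by
  conv_rhs => rw [← l.2]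
  exact Finset.sum_le_sum_of_subset (Finset.subset_univ _)

theorem block_unique (l : Compos r n) {i j : Fin n} {x : Fin (r + 1)} (hi : x ∈ l.block i)
    (hj : x ∈ l.block j) : i = j := by
  have key : ∀ {i j : Fin n}, x ∈ l.block i → x ∈ l.block j → ¬ i < j := by
    intro i j hi hj hij
    have : ∑ m ∈ Finset.Iic i, l.1 m ≤ ∑ m ∈ Finset.Iio j, l.1 m :=
      Finset.sum_le_sum_of_subset fun m hm =>
        Finset.mem_Iio.2 (lt_of_le_of_lt (Finset.mem_Iic.1 hm) hij)
    exact absurd hj.1 (not_lt.2 (hi.2.trans this))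
  exact le_antisymm (not_lt.1 (key hj hi)) (not_lt.1 (key hi hj))

theorem exists_mem_block (l : Compos r n) {x : Fin (r + 1)} (hx : x ≠ 0) : ∃ i, x ∈ l.block i := by
  have hP : ∃ m, (x : ℕ) ≤ ∑ j : Fin n with j.1 < m, l.1 j := by
    refine ⟨n, ?_⟩
    rw [Finset.filter_true_of_mem fun j _ => j.2, l.2]
    exact Nat.lt_succ_iff.1 x.2
  classical
  -- The least number `m` of initial parts whose sum reaches `x`; the block sought is the last of
  -- them, of index `m - 1`.
  obtain ⟨m, hm, hmin⟩ : ∃ m, (x : ℕ) ≤ ∑ j : Fin n with j.1 < m, l.1 j ∧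
      ∀ m' < m, ¬ (x : ℕ) ≤ ∑ j : Fin n with j.1 < m', l.1 j :=
    ⟨Nat.find hP, Nat.find_spec hP, fun m' => Nat.find_min hP⟩
  have hx' : 0 < (x : ℕ) := Nat.pos_of_ne_zero fun h => hx (Fin.ext h)
  obtain _ | m := m
  · simp at hm
    omega
  have hm' := hmin m (Nat.lt_succ_self m)
  have hmn : m < n := by
    by_contra hmn
    refine hm' (hm.trans (Finset.sum_le_sum_of_subset fun j _ => ?_))
    simp only [Finset.mem_filter, Finset.mem_univ, true_and]
    omega
  refine ⟨⟨m, hmn⟩, ?_, ?_⟩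
  · rw [not_le] at hm'
    refine lt_of_eq_of_lt (Finset.sum_congr ?_ fun _ _ => rfl) hm'
    ext j
    simp [Fin.lt_def]
  · refine hm.trans_eq (Finset.sum_congr ?_ fun _ _ => rfl)
    ext j
    simp [Fin.le_def]

open Classical in
/-- The index of the block of `x`, and `none` for `x = 0`. -/
noncomputable def color (l : Compos r n) (x : Fin (r + 1)) : Option (Fin n) :=
  if h : ∃ i, x ∈ l.block i then some h.choose else none

theorem color_eq_some (l : Compos r n) {x : Fin (r + 1)} {i : Fin n} :
    l.color x = some i ↔ x ∈ l.block i := by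
  unfold color
  split_ifs with h
  · rw [Option.some_inj]
    exact ⟨fun e => e ▸ h.choose_spec, fun e => l.block_unique h.choose_spec e⟩
  · exact ⟨fun e => by simp at e, fun e => (h ⟨i, e⟩).elim⟩

theorem color_eq_none (l : Compos r n) {x : Fin (r + 1)} : l.color x = none ↔ x = 0 := by
  constructor
  · intro h
    by_contra hx
    obtain ⟨i, hi⟩ := l.exists_mem_block hx
    rw [← color_eq_some, h] at hi
    simp at hi
  · rintro rfl
    cases h : l.color 0 with
    | none => rfl
    | some i =>
      rw [color_eq_some] at h
      exact absurd h.1 (by simp)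

theorem color_zero (l : Compos r n) : l.color 0 = none := l.color_eq_none.2 rfl

open Classical in
theorem card_color (l : Compos r n) (i : Fin n) :
    (Finset.univ.filter fun x => l.color x = some i).card = l.1 i := by
  have h := l.sum_Iic_eq i
  have h' := l.sum_Iic_le i
  have : ((Finset.univ.filter fun x => l.color x = some i).image Fin.val) =
      Finset.Ioc (∑ j ∈ Finset.Iio i, l.1 j) (∑ j ∈ Finset.Iic i, l.1 j) := by
    ext y
    simp only [Finset.mem_image, Finset.mem_filter, Finset.mem_univ, true_and, Finset.mem_Ioc,
      color_eq_some]
    constructor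
    · rintro ⟨x, hx, rfl⟩
      exact hx
    · rintro ⟨h1, h2⟩
      exact ⟨⟨y, by omega⟩, ⟨h1, h2⟩, rfl⟩
  rw [← Finset.card_image_of_injective _ Fin.val_injective, this, Nat.card_Ioc, h]
  omega

/-- Every colouring of `{1, …, r}` is, up to a permutation, that of a composition. -/
theorem exists_color_eq (c : Fin (r + 1) → Option (Fin n)) (hc : ∀ x, c x = none ↔ x = 0) :
    ∃ (m : Compos r n) (w : Equiv.Perm (Fin (r + 1))), w 0 = 0 ∧ ∀ x, c (w x) = m.color x := by
  classical
  have h0 : (Finset.univ.filter fun x => c x = none).card = 1 := by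
    rw [Finset.card_eq_one]
    exact ⟨0, by ext x; simp [hc]⟩
  have hsum : ∑ i, (Finset.univ.filter fun x => c x = some i).card = r := by
    have := Finset.card_eq_sum_card_fiberwise (f := c) (s := Finset.univ) (t := Finset.univ)
      (fun _ _ => Finset.mem_univ _)
    rw [Fintype.sum_option, h0, Finset.card_univ, Fintype.card_fin] at this
    omega
  let m : Compos r n := ⟨fun i => (Finset.univ.filter fun x => c x = some i).card, hsum⟩
  have hcard : ∀ o, Nonempty ({x // m.color x = o} ≃ {x // c x = o}) := by
    intro o
    refine ⟨Fintype.equivOfCardEq ?_⟩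
    rw [Fintype.card_subtype, Fintype.card_subtype]
    cases o with
    | none =>
      rw [h0, Finset.card_eq_one]
      exact ⟨0, by ext x; simp [color_eq_none]⟩
    | some i => rw [card_color]
  have e := fun o => (hcard o).some
  have he : ∀ x, c (Equiv.ofFiberEquiv e x) = m.color x := Equiv.ofFiberEquiv_map e
  refine ⟨m, Equiv.ofFiberEquiv e, ?_, he⟩
  rw [← hc, he, color_zero]

/-- The number of integers in the blocks of size at least `q`. -/
def above (l : Compos r n) (q : ℕ) : ℕ := ∑ j ∈ Finset.univ.filter (fun j => q ≤ l.1 j), l.1 j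

theorem above_le (l : Compos r n) (q : ℕ) : l.above q ≤ r := by
  conv_rhs => rw [← l.2]
  exact Finset.sum_le_sum_of_subset (Finset.subset_univ _)

theorem above_of_le_one (l : Compos r n) {q : ℕ} (hq : q ≤ 1) : l.above q = r := by
  conv_rhs => rw [← l.2]
  refine Finset.sum_subset (Finset.subset_univ _) fun j _ h => ?_
  simp only [Finset.mem_filter, Finset.mem_univ, true_and] at h
  omega

-- Counting points instead of adding parts allows `above` to be compared for two compositions by
-- means of an injection of points.
open Classical in
theorem above_eq_card (l : Compos r n) (q : ℕ) : l.above q =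
    (Finset.univ.filter fun x : Fin (r + 1) => ∃ i, l.color x = some i ∧ q ≤ l.1 i).card := by
  rw [above, Finset.card_eq_sum_card_fiberwise (f := l.color)
    (t := (Finset.univ.filter (fun j => q ≤ l.1 j)).image some)]
  · rw [Finset.sum_image fun _ _ _ _ h => Option.some_injective _ h]
    refine Finset.sum_congr rfl fun j hj => ?_
    simp only [Finset.mem_filter, Finset.mem_univ, true_and] at hj
    rw [← card_color]
    congr 1
    ext x
    simp only [Finset.mem_filter, Finset.mem_univ, true_and]
    exact ⟨fun h => ⟨⟨j, h, hj⟩, h⟩, fun h => h.2⟩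
  · intro x hx
    simp only [Finset.coe_filter, Finset.mem_univ, true_and, Set.mem_ofPred_eq] at hx
    obtain ⟨i, hi, h⟩ := hx
    simp only [Finset.coe_image, Set.mem_image, Finset.coe_filter, Finset.mem_univ, true_and,
      Set.mem_ofPred_eq]
    exact ⟨i, h, hi.symm⟩

theorem plus_antitone (l : Compos r n) : Antitone l.plus := fun _ _ h =>
  Tuple.monotone_sort l.1 (Fin.rev_le_rev.2 h)

theorem above_eq_plus (l : Compos r n) (q : ℕ) :
    l.above q = ∑ j ∈ Finset.univ.filter (fun j => q ≤ l.plus j), l.plus j := by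
  rw [above, Finset.sum_filter, Finset.sum_filter]
  exact (Equiv.sum_comp (Fin.revPerm.trans (Tuple.sort l.1)) fun j =>
    if q ≤ l.1 j then l.1 j else 0).symm

/-- Take for `q` the part of `l` at the first place where the rearrangements differ. Parts of `m` of
size at least `q` all come earlier, where both agree, while `l` has one more such part. -/
theorem Below.exists_above_lt {m l : Compos r n} (h : m.Below l) :
    ∃ q, m.above q < l.above q := by
  obtain ⟨k, he, hk⟩ := h
  refine ⟨l.plus k, ?_⟩
  have h1 : m.above (l.plus k) ≤ ∑ j ∈ Finset.Iio k, m.plus j := by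
    rw [above_eq_plus]
    refine Finset.sum_le_sum_of_subset fun j hj => ?_
    simp only [Finset.mem_filter, Finset.mem_univ, true_and, Finset.mem_Iio] at hj ⊢
    by_contra hj'
    exact absurd (m.plus_antitone (not_lt.1 hj')) (by omega)
  have h2 : ∑ j ∈ Finset.Iic k, l.plus j ≤ l.above (l.plus k) := by
    rw [above_eq_plus]
    refine Finset.sum_le_sum_of_subset fun j hj => ?_
    simp only [Finset.mem_filter, Finset.mem_univ, true_and, Finset.mem_Iic] at hj ⊢
    exact l.plus_antitone hj
  have h3 : ∑ j ∈ Finset.Iio k, m.plus j = ∑ j ∈ Finset.Iio k, l.plus j :=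
    Finset.sum_congr rfl fun j hj => he j (Finset.mem_Iio.1 hj)
  rw [← Finset.Iio_insert, Finset.sum_insert (by simp)] at h2
  omega

/-- At the first place where the rearrangements differ, a larger part of `m` would, taken as
threshold, give `m` the larger value of `above`. -/
theorem below_of_above_le {m l : Compos r n} (h : ∀ q, m.above q ≤ l.above q)
    (hlt : ∃ q, m.above q < l.above q) : m.Below l := by
  have hne : ∃ k, m.plus k ≠ l.plus k := by
    by_contra! hne
    obtain ⟨q, hq⟩ := hlt
    rw [above_eq_plus, above_eq_plus, funext hne] at hq
    exact lt_irrefl _ hq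
  obtain ⟨k, hk, hmin⟩ := WellFounded.has_min (wellFounded_lt (α := Fin n))
    {k | m.plus k ≠ l.plus k} hne
  have he : ∀ i < k, m.plus i = l.plus i := fun i hi => by
    by_contra h
    exact hmin i h hi
  refine ⟨k, he, lt_of_le_of_ne ?_ hk⟩
  by_contra hlt
  rw [not_le] at hlt
  have h1 : l.above (m.plus k) ≤ ∑ j ∈ Finset.Iio k, l.plus j := by
    rw [above_eq_plus]
    refine Finset.sum_le_sum_of_subset fun j hj => ?_
    simp only [Finset.mem_filter, Finset.mem_univ, true_and, Finset.mem_Iio] at hj ⊢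
    by_contra hj'
    exact absurd (l.plus_antitone (not_lt.1 hj')) (by omega)
  have h2 : ∑ j ∈ Finset.Iic k, m.plus j ≤ m.above (m.plus k) := by
    rw [above_eq_plus]
    refine Finset.sum_le_sum_of_subset fun j hj => ?_
    simp only [Finset.mem_filter, Finset.mem_univ, true_and, Finset.mem_Iic] at hj ⊢
    exact m.plus_antitone hj
  have h3 : ∑ j ∈ Finset.Iio k, m.plus j = ∑ j ∈ Finset.Iio k, l.plus j :=
    Finset.sum_congr rfl fun j hj => he j (Finset.mem_Iio.1 hj)
  rw [← Finset.Iio_insert, Finset.sum_insert (by simp)] at h2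
  have := h (m.plus k)
  omega

/-- Splitting a block of a composition makes the composition smaller. -/
theorem below_of_color (l m : Compos r n) (w : Equiv.Perm (Fin (r + 1)))
    (h : ∀ x y, m.color x = m.color y → l.color (w x) = l.color (w y))
    {x y : Fin (r + 1)} (hxy : l.color (w x) = l.color (w y)) (hne : m.color x ≠ m.color y)
    (hw : w 0 = 0) : m.Below l := by
  classical
  -- `w` carries the `m`-block of `z` into an `l`-block. If the sizes agree it fills that block, so
  -- the block is not split.
  have hz : ∀ z, z ≠ 0 → ∃ i j, m.color z = some i ∧ l.color (w z) = some j ∧ m.1 i ≤ l.1 j ∧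
      (m.1 i = l.1 j → ∀ z', l.color (w z') = l.color (w z) → m.color z' = m.color z) := by
    intro z hz
    obtain ⟨i, hi⟩ := m.exists_mem_block hz
    obtain ⟨j, hj⟩ := l.exists_mem_block (x := w z) fun h => hz (w.injective (h.trans hw.symm))
    rw [← color_eq_some] at hi hj
    have hsub : (Finset.univ.filter fun x => m.color x = some i).image w ⊆
        Finset.univ.filter fun x => l.color x = some j := by
      intro u hu
      simp only [Finset.mem_image, Finset.mem_filter, Finset.mem_univ, true_and] at hu ⊢
      obtain ⟨v, hv, rfl⟩ := hu
      rw [h v z (hv.trans hi.symm), hj]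
    refine ⟨i, j, hi, hj, ?_, fun heq z' hz' => ?_⟩
    · rw [← card_color, ← card_color, ← Finset.card_image_of_injective _ w.injective]
      exact Finset.card_le_card hsub
    · rw [← card_color, ← card_color, ← Finset.card_image_of_injective _ w.injective] at heq
      have := Finset.eq_of_subset_of_card_le hsub heq.ge
      have hz'' : w z' ∈ Finset.univ.filter fun x => l.color x = some j := by
        simp [hz', hj]
      rw [← this] at hz''
      simp only [Finset.mem_image, Finset.mem_filter, Finset.mem_univ, true_and] at hz''
      obtain ⟨v, hv, e⟩ := hz''
      rw [← w.injective e, hv, hi]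
  have hx0 : x ≠ 0 := by
    rintro rfl
    rw [hw, color_zero, eq_comm, color_eq_none] at hxy
    have : y = 0 := w.injective (hxy.trans hw.symm)
    exact hne (by rw [this])
  have hsub : ∀ q, (Finset.univ.filter fun x => ∃ i, m.color x = some i ∧ q ≤ m.1 i).image w ⊆
      Finset.univ.filter fun x => ∃ i, l.color x = some i ∧ q ≤ l.1 i := by
    intro q u hu
    simp only [Finset.mem_image, Finset.mem_filter, Finset.mem_univ, true_and] at hu ⊢
    obtain ⟨v, ⟨i, hi, hq⟩, rfl⟩ := hu
    have hv : v ≠ 0 := by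
      rintro rfl
      simp [color_zero] at hi
    obtain ⟨i', j, hi', hj, hle, _⟩ := hz v hv
    rw [hi, Option.some_inj] at hi'
    subst hi'
    exact ⟨j, hj, hq.trans hle⟩
  refine below_of_above_le (fun q => ?_) ?_
  · rw [above_eq_card, above_eq_card, ← Finset.card_image_of_injective _ w.injective]
    exact Finset.card_le_card (hsub q)
  · obtain ⟨i, j, hi, hj, hle, heq⟩ := hz x hx0
    -- The size of the split block is a threshold with strict inequality: `w x` is counted for `l`,
    -- but the `m`-block of `x` is too small.
    refine ⟨l.1 j, ?_⟩
    rw [above_eq_card, above_eq_card, ← Finset.card_image_of_injective _ w.injective]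
    refine Finset.card_lt_card ((Finset.ssubset_iff_of_subset (hsub _)).2 ⟨w x, ?_, ?_⟩)
    · simp [hj]
    · simp only [Finset.mem_image, Finset.mem_filter, Finset.mem_univ, true_and, not_exists, not_and]
      rintro v ⟨i', hi', hq⟩ e
      rw [w.injective e, hi, Option.some_inj] at hi'
      subst hi'
      exact hne (heq (le_antisymm hle hq) y hxy.symm).symm

end Compos

/-! ### Young subgroups, and factoring basis elements through a split block. -/

section Units

variable {r n : ℕ} {S : Submonoid (Function.End (Fin (r + 1)))}

/-- A permutation fixing `0`, as a unit of `S`. -/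
def permUnit (hsym : sym r ≤ S) (e : Equiv.Perm (Fin (r + 1))) (h : e 0 = 0) : (S)ˣ where
  val := ⟨fun x => e x, hsym ⟨h, e.bijective⟩⟩
  inv := ⟨fun x => e.symm x, hsym ⟨by rw [Equiv.symm_apply_eq, h], e.symm.bijective⟩⟩
  val_inv := Subtype.ext (funext e.apply_symm_apply)
  inv_val := Subtype.ext (funext e.symm_apply_apply)

theorem unit_inv_apply (u : (S)ˣ) (x : Fin (r + 1)) : (u⁻¹ : (S)ˣ).1.1 ((u : S).1 x) = x :=
  congrFun (congrArg Subtype.val u.inv_mul) x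

theorem unit_apply_inv (u : (S)ˣ) (x : Fin (r + 1)) : (u : S).1 ((u⁻¹ : (S)ˣ).1.1 x) = x :=
  congrFun (congrArg Subtype.val u.mul_inv) x

theorem unit_injective (u : (S)ˣ) : Function.Injective (u : S).1 :=
  Function.LeftInverse.injective (unit_inv_apply u)

theorem mem_young {l : Compos r n} {u : (S)ˣ} :
    u ∈ l.young S ↔ ∀ x, l.color ((u : S).1 x) = l.color x := by
  change (∀ i x, (u : S).1 x ∈ l.block i ↔ x ∈ l.block i) ↔ _
  simp only [← Compos.color_eq_some]
  constructor
  · intro h x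
    exact Option.ext fun i => h i x
  · intro h i x
    rw [h]

theorem permUnit_mem_young (hsym : sym r ≤ S) {l : Compos r n} {e : Equiv.Perm (Fin (r + 1))}
    {h : e 0 = 0} : permUnit hsym e h ∈ l.young S ↔ ∀ x, l.color (e x) = l.color x := mem_young

/-- Recolour `Z` with the index of an empty part. Such a part exists: the block of `y` has two
points, so if all parts were positive their sum would exceed `n ≥ r`. The permutation `w` then makes
the new colour classes consecutive. -/
theorem Compos.exists_split (hrn : r ≤ n) (l : Compos r n) (Z : Set (Fin (r + 1)))
    {y y' : Fin (r + 1)} (hy : y ∈ Z) (hy' : y' ∉ Z) (h : l.color y = l.color y')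
    (h0 : y ≠ 0) (hZ : ∀ z ∈ Z, l.color z = l.color y) :
    ∃ (m : Compos r n) (w : Equiv.Perm (Fin (r + 1))), w 0 = 0 ∧ m.Below l ∧
      ∀ x x', m.color x = m.color x' ↔ l.color (w x) = l.color (w x') ∧ (w x ∈ Z ↔ w x' ∈ Z) := by
  classical
  obtain ⟨j, hj⟩ := l.exists_mem_block h0
  rw [← color_eq_some] at hj
  obtain ⟨i, hi⟩ : ∃ i, l.1 i = 0 := by
    by_contra! hpos
    have h1 : ∑ i : Fin n, 1 < ∑ i, l.1 i := by
      refine Finset.sum_lt_sum (fun i _ => Nat.pos_of_ne_zero (hpos i)) ⟨j, Finset.mem_univ _, ?_⟩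
      rw [← card_color, Finset.one_lt_card]
      refine ⟨y, by simpa using hj, y', by simpa [← h] using hj, ?_⟩
      rintro rfl
      exact hy' hy
    rw [l.2] at h1
    simp at h1
    omega
  have hci : ∀ x, l.color x ≠ some i := by
    intro x hx
    have := l.card_color i
    rw [hi, Finset.card_eq_zero] at this
    have hx' : x ∈ Finset.univ.filter fun x => l.color x = some i := by simpa using hx
    rw [this] at hx'
    simp at hx'
  have hc0 : ∀ x, (if x ∈ Z then some i else l.color x) = none ↔ x = 0 := by
    intro x
    split_ifs with hx
    · simp only [false_iff]
      rintro rfl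
      have := hZ _ hx
      rw [color_zero, hj] at this
      simp at this
    · exact l.color_eq_none
  obtain ⟨m, w, hw, hmw⟩ := exists_color_eq _ hc0
  have key : ∀ x x', m.color x = m.color x' ↔
      l.color (w x) = l.color (w x') ∧ (w x ∈ Z ↔ w x' ∈ Z) := by
    intro x x'
    rw [← hmw, ← hmw]
    split_ifs with h1 h2 h2
    · simp [h1, h2, hZ]
    · simp [h1, h2, (hci _).symm]
    · simp [h1, h2, hci]
    · simp [h1, h2]
  refine ⟨m, w, hw, l.below_of_color m w (fun x x' hx => ((key x x').1 hx).1)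
    (x := w.symm y) (y := w.symm y') (by simpa using h) (fun hm => ?_) hw, key⟩
  have := ((key _ _).1 hm).2
  simp [hy, hy'] at this

variable (k : Type*) [Field k]

open Classical in
theorem eBelow_eq_diag (l : Compos r n) :
    eBelow k S l = LAlg.diag (M := S) fun m : Compos r n => if m.Below l then (1 : k) else 0 := by
  refine LAlg.ext' fun i j D => ?_
  have hsum : ∀ s : Finset (Compos r n), (∑ m ∈ s, oneAt k S m).coeff i j D =
      ∑ m ∈ s, (oneAt k S m).coeff i j D := by
    intro s
    induction s using Finset.induction_on with
    | empty => rfl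
    | insert a s ha ih => rw [Finset.sum_insert ha, Finset.sum_insert ha, LAlg.add_coeff, ih]
  rw [eBelow, hsum]
  simp only [oneAt, LAlg.idem_eq_diag, LAlg.diag]
  split_ifs with h h'
  · simp [Pi.single_apply, h']
  · simp [Pi.single_apply, h']
  · simp

/-- The idempotent `e_l` acts as a right unit on `f(l, D₁, m)` because `1_m` is one of its summands.
-/
theorem f_mul_f_mem_span {l m : Compos r n} (hm : m.Below l)
    (D₁ : DC (fun l : Compos r n => l.young S) l m)
    (D₂ : DC (fun l : Compos r n => l.young S) m l) :
    LAlg.f k l m D₁ * LAlg.f k m l D₂ ∈ TwoSidedIdeal.span {eBelow k S l} := by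
  classical
  have : LAlg.f k l m D₁ = LAlg.f k l m D₁ * eBelow k S l := by
    refine LAlg.ext' fun i j D => ?_
    rw [eBelow_eq_diag, LAlg.mul_diag_coeff]
    by_cases hj : j = m
    · subst hj
      rw [if_pos hm, mul_one]
    · rw [LAlg.f_coeff, if_neg, zero_mul]
      intro h
      simp only [Sigma.mk.injEq, Prod.mk.injEq] at h
      exact hj h.1.2.symm
  rw [this]
  exact TwoSidedIdeal.mul_mem_right _ _ _
    (TwoSidedIdeal.mul_mem_left _ _ _ (TwoSidedIdeal.subset_span rfl))

section Split

variable (hsym : sym r ≤ S) (l : Compos r n) (Z : Set (Fin (r + 1)))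
    {m : Compos r n} {w : Equiv.Perm (Fin (r + 1))} (hw : w 0 = 0)
    (h : ∀ x x', m.color x = m.color x' ↔
      l.color (w x) = l.color (w x') ∧ (w x ∈ Z ↔ w x' ∈ Z))

-- The blocks of `m`, moved by `w`, refine those of `l`.
include h in
theorem conj_mem_young {ρ : (S)ˣ} (hρ : ρ ∈ m.young S) :
    permUnit hsym w hw * ρ * (permUnit hsym w hw)⁻¹ ∈ l.young S := by
  rw [mem_young] at hρ ⊢
  intro x
  have := ((h _ _).1 (hρ (w.symm x))).1
  rwa [Equiv.apply_symm_apply] at this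

-- The refinement only separates `Z` from its complement, so an element of the Young subgroup of `l`
-- that preserves `Z` preserves the finer blocks as well.
include h in
theorem conj_symm_mem_young {σ : (S)ˣ} (hσ : σ ∈ l.young S)
    (hZ : ∀ x, (σ : S).1 x ∈ Z ↔ x ∈ Z) :
    (permUnit hsym w hw)⁻¹ * σ * permUnit hsym w hw ∈ m.young S := by
  rw [mem_young] at hσ ⊢
  intro x
  change m.color (w.symm ((σ : S).1 (w x))) = _
  rw [h, Equiv.apply_symm_apply]
  exact ⟨hσ _, hZ _⟩

end Split

/-- If the stabilizer of the left coset of `α` may be realized by elements of the Young subgroup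
which preserve a proper subset `Z` of a block, `f(l, α, l)` is in the ideal. -/
theorem f_mem_span_of_target (hrn : r ≤ n) (hsym : sym r ≤ S) (l : Compos r n)
    (Z : Set (Fin (r + 1))) {y y' : Fin (r + 1)} (hy : y ∈ Z) (hy' : y' ∉ Z)
    (hyy : l.color y = l.color y') (h0 : y ≠ 0) (hZ : ∀ z ∈ Z, l.color z = l.color y) (α : S)
    (H : ∀ π ∈ l.young S, ∀ σ ∈ l.young S, α * (π : S) = (σ : S) * α →
      ∃ σ' ∈ l.young S, (∀ x, (σ' : S).1 x ∈ Z ↔ x ∈ Z) ∧ α * (π : S) = (σ' : S) * α) :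
    LAlg.f k l l (dc (fun l : Compos r n => l.young S) l l α) ∈
      TwoSidedIdeal.span {eBelow k S l} := by
  obtain ⟨m, w, hw, hm, h⟩ := l.exists_split hrn Z hy hy' hyy h0 hZ
  set W := permUnit hsym w hw with hW
  -- This is the factorization through `m`: `f(l, α, l) = f(l, w, m) f(m, w⁻¹ α, l)`.
  have hα : α = (W : S) * (((W⁻¹ : (S)ˣ) : S) * α) := by simp
  have hf := LAlg.f_mul_f (R := k) (G := fun l : Compos r n => l.young S) (i := l) (j := m) (k := l)
    (a := (W : S)) (b := ((W⁻¹ : (S)ˣ) : S) * α) ?_ ?_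
  · rw [← hα] at hf
    rw [← hf]
    exact f_mul_f_mem_span k hm _ _
  · intro ρ hρ
    rw [← hα, ← dc_mul_mul (conj_mem_young hsym l Z hw h hρ) (one_mem (l.young S)) α]
    congr 1
  -- The first factor has the whole Young subgroup of `m` as stabilizer. The second has the same
  -- stabilizer as `α`: `H` supplies a `σ'` that preserves `Z` and so descends to `m`.
  · rw [← hα, mul_comm]
    congr 1
    · rw [nL_dc]
      refine Nat.card_congr (Equiv.subtypeEquivRight fun ρ => ?_)
      rw [mem_stabL]
      exact ⟨fun hρ => ⟨hρ, _, conj_mem_young hsym l Z hw h hρ, by simp [hW]⟩, fun hρ => hρ.1⟩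
    · rw [nL_dc, nL_dc]
      refine Nat.card_congr (Equiv.subtypeEquivRight fun π => ?_)
      rw [mem_stabL, mem_stabL]
      refine and_congr_right fun hπ => ⟨?_, ?_⟩
      · rintro ⟨σ, hσ, e⟩
        obtain ⟨σ', hσ', hZ', e'⟩ := H π hπ σ hσ e
        refine ⟨_, conj_symm_mem_young hsym l Z hw h hσ' hZ', ?_⟩
        rw [mul_assoc, e']
        simp [hW, mul_assoc]
      · rintro ⟨ρ, hρ, e⟩
        refine ⟨_, conj_mem_young hsym l Z hw h hρ, ?_⟩
        rw [mul_assoc, Units.inv_mul_eq_iff_eq_mul] at e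
        rw [e]
        simp [hW, mul_assoc]

/-- If the stabilizer of the left coset of `α` preserves a proper subset `Z` of a block, `f(l, α, l)`
is in the ideal. -/
theorem f_mem_span_of_source (hrn : r ≤ n) (hsym : sym r ≤ S) (l : Compos r n)
    (Z : Set (Fin (r + 1))) {y y' : Fin (r + 1)} (hy : y ∈ Z) (hy' : y' ∉ Z)
    (hyy : l.color y = l.color y') (h0 : y ≠ 0) (hZ : ∀ z ∈ Z, l.color z = l.color y) (α : S)
    (H : ∀ π ∈ l.young S, ∀ σ ∈ l.young S, α * (π : S) = (σ : S) * α →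
      ∀ x, (π : S).1 x ∈ Z ↔ x ∈ Z) :
    LAlg.f k l l (dc (fun l : Compos r n => l.young S) l l α) ∈
      TwoSidedIdeal.span {eBelow k S l} := by
  obtain ⟨m, w, hw, hm, h⟩ := l.exists_split hrn Z hy hy' hyy h0 hZ
  set W := permUnit hsym w hw with hW
  -- Now `m` is inserted on the source side: `f(l, α, l) = f(l, α w, m) f(m, w⁻¹, l)`.
  have hα : α = α * (W : S) * ((W⁻¹ : (S)ˣ) : S) := by simp
  have hf := LAlg.f_mul_f (R := k) (G := fun l : Compos r n => l.young S) (i := l) (j := m) (k := l)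
    (a := α * (W : S)) (b := ((W⁻¹ : (S)ˣ) : S)) ?_ ?_
  · rw [← hα] at hf
    rw [← hf]
    exact f_mul_f_mem_span k hm _ _
  · intro ρ hρ
    rw [← hα, ← dc_mul_mul (one_mem (l.young S)) (conj_mem_young hsym l Z hw h hρ) α]
    congr 1
  -- Conjugation by `w` identifies the stabilizer of `α`, which preserves `Z`, with that of `α w`,
  -- and the Young subgroup of `m` with the stabilizer of `w⁻¹`.
  · rw [← hα]
    congr 1
    · rw [nL_dc, nL_dc]
      refine Nat.card_congr (Equiv.subtypeEquiv (MulAut.conj W⁻¹).toEquiv fun π => ?_)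
      rw [mem_stabL, mem_stabL]
      simp only [MulEquiv.toEquiv_eq_coe, MulEquiv.coe_toEquiv, MulAut.conj_apply, inv_inv]
      constructor
      · rintro ⟨hπ, σ, hσ, e⟩
        refine ⟨conj_symm_mem_young hsym l Z hw h hπ (H π hπ σ hσ e), σ, hσ, ?_⟩
        rw [← mul_assoc, ← e]
        simp [hW, mul_assoc]
      · rintro ⟨hπ, σ, hσ, e⟩
        refine ⟨?_, σ, hσ, ?_⟩
        · have := conj_mem_young hsym l Z hw h hπ
          simpa [← hW, mul_assoc] using this
        · rw [← mul_assoc, Units.val_mul, ← mul_assoc, Units.mul_left_inj] at e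
          rw [← e]
          simp [mul_assoc]
    · rw [nL_dc]
      refine Nat.card_congr (Equiv.subtypeEquiv (MulAut.conj W).toEquiv fun ρ => ?_)
      rw [mem_stabL]
      simp only [MulEquiv.toEquiv_eq_coe, MulEquiv.coe_toEquiv, MulAut.conj_apply]
      constructor
      · intro hρ
        exact ⟨conj_mem_young hsym l Z hw h hρ, ρ, hρ, by simp [mul_assoc]⟩
      · rintro ⟨_, σ, hσ, e⟩
        have : ρ = σ := by
          rw [← Units.val_mul, ← Units.val_mul, Units.val_inj] at e
          simpa [← mul_assoc] using e
        rwa [this]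

end Units

/-! ### Structure constants through smaller compositions vanish modulo `p`. -/

section Divisibility

variable {r n : ℕ} {S : Submonoid (Function.End (Fin (r + 1)))}

theorem unit_map_zero (hS : S ≤ tauBar r) (a : S) : a.1 0 = 0 := hS a.2

theorem ncard_color (l : Compos r n) (i : Fin n) : {x | l.color x = some i}.ncard = l.1 i := by
  classical
  rw [← l.card_color i, Set.ncard_eq_toFinset_card']
  congr 1
  ext x
  simp

theorem relIndex_stabilizer {G X : Type*} [Group G] [MulAction G X] (K : Subgroup G) (x : X) :
    (MulAction.stabilizer G x).relIndex K = (MulAction.orbit K x).ncard := by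
  rw [← MulAction.index_stabilizer]
  rfl

theorem orbit_young (hsym : sym r ≤ S) {l : Compos r n} {i : Fin n} {x : Fin (r + 1)}
    (hx : l.color x = some i) :
    MulAction.orbit (l.young S) x = {y | l.color y = some i} := by
  classical
  ext y
  constructor
  · rintro ⟨u, rfl⟩
    exact (mem_young.1 u.2 x).trans hx
  · intro hy
    change l.color y = some i at hy
    have h0 : ∀ {z}, l.color z = some i → z ≠ 0 := by
      rintro _ hz rfl
      rw [l.color_zero] at hz
      simp at hz
    refine ⟨⟨permUnit hsym (Equiv.swap x y)
      (Equiv.swap_apply_of_ne_of_ne (h0 hx).symm (h0 hy).symm),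
      (permUnit_mem_young hsym).2 fun z => ?_⟩, Equiv.swap_apply_left x y⟩
    rw [Equiv.swap_apply_def]
    split_ifs with h1 h2
    · rw [h1, hx, hy]
    · rw [h2, hx, hy]
    · rfl

/-- A subgroup of index prime to `p` of a Young subgroup is transitive on the blocks whose size is
a power of `p`. -/
theorem exists_smul_eq_of_relIndex {p : ℕ} (hp : p.Prime) (hsym : sym r ≤ S) {l : Compos r n}
    {i : Fin n} {e : ℕ} (hi : l.1 i = p ^ e) (H : Subgroup (S)ˣ) (hH : H ≤ l.young S)
    (hpH : ¬ p ∣ H.relIndex (l.young S)) {x y : Fin (r + 1)} (hx : l.color x = some i)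
    (hy : l.color y = some i) : ∃ π ∈ H, (π : S).1 x = y := by
  set T := MulAction.stabilizer (S)ˣ x
  set G := l.young S
  have hTG : T.relIndex G = p ^ e := by
    rw [relIndex_stabilizer, orbit_young hsym hx, ncard_color, hi]
  -- The index of `T ⊓ H` in `G` is computed through `H` and through `T ⊓ G`. The second way shows a
  -- factor `p ^ e`, which is coprime to the index of `H`, so `p ^ e` divides the length of the
  -- `H`-orbit of `x`.
  have h1 := Subgroup.relIndex_mul_relIndex (T ⊓ H) H G inf_le_right hH
  have h2 := Subgroup.relIndex_mul_relIndex (T ⊓ H) (T ⊓ G) G (inf_le_inf_left _ hH) inf_le_right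
  rw [Subgroup.inf_relIndex_right] at h1 h2
  have h3 : p ^ e ∣ T.relIndex H := by
    refine Nat.Coprime.dvd_of_dvd_mul_right (n := H.relIndex G) ?_ ?_
    · exact (hp.coprime_iff_not_dvd.2 hpH).pow_left e
    · rw [h1, ← h2, hTG]
      exact dvd_mul_left _ _
  rw [relIndex_stabilizer] at h3
  have hsub : MulAction.orbit H x ⊆ {y | l.color y = some i} := by
    rintro _ ⟨u, rfl⟩
    exact (mem_young.1 (hH u.2) x).trans hx
  have heq : MulAction.orbit H x = {y | l.color y = some i} := by
    refine Set.eq_of_subset_of_ncard_le hsub ?_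
    rw [ncard_color, hi]
    refine Nat.le_of_dvd ?_ h3
    rw [Set.ncard_pos]
    exact ⟨x, MulAction.mem_orbit_self x⟩
  have : y ∈ MulAction.orbit H x := heq ▸ hy
  obtain ⟨u, hu⟩ := this
  exact ⟨u.1, u.2, hu⟩

/-- The structure constants of products through smaller compositions vanish mod `p` at double
cosets consisting of a single left coset of a map which is injective on large blocks. -/
theorem dvd_coef {p : ℕ} (hp : p.Prime) (hsym : sym r ≤ S) (hS : S ≤ tauBar r) {l m : Compos r n}
    (hlp : l.IsPPowers p) (hm : m.Below l) (α : S)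
    (hα : nL (dc (fun l : Compos r n => l.young S) l l α) = Nat.card (l.young S))
    (hne : ∀ x i, l.color x = some i → 2 ≤ l.1 i → α.1 x ≠ 0)
    (hinj : ∀ x y i j, l.color x = some i → 2 ≤ l.1 i → l.color y = some j → 2 ≤ l.1 j →
      α.1 x = α.1 y → x = y)
    (D₁ : DC (fun l : Compos r n => l.young S) l m)
    (D₂ : DC (fun l : Compos r n => l.young S) m l) :
    p ∣ coef D₁ D₂ (dc (fun l : Compos r n => l.young S) l l α) := by
  classical
  obtain ⟨a, rfl⟩ := dc_surj D₁
  obtain ⟨b, rfl⟩ := dc_surj D₂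
  by_contra hcon
  have hidx : ¬ p ∣ (stabL (fun l : Compos r n => l.young S) m l b).relIndex (l.young S) :=
    fun h => hcon (h.trans (relIndex_dvd_coef _ b _ hα))
  -- A nonzero structure constant forces `N ≠ 0`, so `α` factors through `b` up to units; `b`
  -- inherits from `α` nonvanishing and injectivity on large blocks.
  obtain ⟨ρ, hρ, σ, hσ, π, hπ, e⟩ : ∃ ρ ∈ m.young S, ∃ σ ∈ l.young S, ∃ π ∈ l.young S,
      (σ : S) * (a * (ρ : S) * b) * (π : S) = α := by
    by_contra! h
    refine hcon ?_
    have : NN (dc (fun l : Compos r n => l.young S) l m a)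
        (dc (fun l : Compos r n => l.young S) m l b)
        (dc (fun l : Compos r n => l.young S) l l α) = 0 := by
      rw [NN_dc, Nat.card_eq_zero]
      refine Or.inl ⟨fun x => ?_⟩
      obtain ⟨σ, hσ, π, hπ, e⟩ := dc_eq_iff.1 x.2.2
      exact h x.1 x.2.1 σ hσ π hπ e
    rw [coef, this]
    simp
  have eapp : ∀ x, (σ : S).1 (a.1 ((ρ : S).1 (b.1 ((π : S).1 x)))) = α.1 x := fun x =>
    congrFun (congrArg Subtype.val e) x
  have hπ' : ∀ x, l.color ((π⁻¹ : (S)ˣ).1.1 x) = l.color x := mem_young.1 (inv_mem hπ)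
  have eapp' : ∀ x, (σ : S).1 (a.1 ((ρ : S).1 (b.1 x))) = α.1 ((π⁻¹ : (S)ˣ).1.1 x) := fun x => by
    rw [← eapp, unit_apply_inv]
  have bne : ∀ x i, l.color x = some i → 2 ≤ l.1 i → b.1 x ≠ 0 := by
    intro x i hx hi h0
    refine hne _ i ((hπ' x).trans hx) hi ?_
    rw [← eapp', h0, unit_map_zero hS, unit_map_zero hS, unit_map_zero hS]
  have binj : ∀ x y i j, l.color x = some i → 2 ≤ l.1 i → l.color y = some j → 2 ≤ l.1 j →
      b.1 x = b.1 y → x = y := by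
    intro x y i j hx hi hy hj h
    refine unit_injective π⁻¹ (hinj _ _ i j ((hπ' x).trans hx) hi ((hπ' y).trans hy) hj ?_)
    rw [← eapp', ← eapp', h]
  -- The stabilizer of `b` is transitive on the block, and `b π = σ b` with `σ` in the Young
  -- subgroup of `m`; hence `b` maps the block into one block of `m`.
  have bcol : ∀ x y i, l.color x = some i → l.color y = some i → 2 ≤ l.1 i →
      m.color (b.1 y) = m.color (b.1 x) := by
    intro x y i hx hy hi
    obtain h0 | ⟨e, he⟩ := hlp i
    · omega
    obtain ⟨π, ⟨_, σ, hσ, hb⟩, rfl⟩ := exists_smul_eq_of_relIndex hp hsym he _ stabL_le hidx hx hy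
    have : b.1 ((π : S).1 x) = (σ : S).1 (b.1 x) := congrFun (congrArg Subtype.val hb) x
    rw [this]
    exact mem_young.1 hσ _
  obtain ⟨q, hq⟩ := hm.exists_above_lt
  -- Below the threshold two, all `r` points are counted on both sides, so only large blocks matter.
  have hq2 : 2 ≤ q := by
    by_contra h
    rw [m.above_of_le_one (by omega), l.above_of_le_one (by omega)] at hq
    exact lt_irrefl _ hq
  refine absurd hq (not_lt.2 ?_)
  rw [Compos.above_eq_card, Compos.above_eq_card]
  refine Finset.card_le_card_of_injOn b.1 ?_ ?_
  · intro x hx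
    simp only [Finset.coe_filter, Finset.mem_univ, true_and, Set.mem_ofPred_eq] at hx ⊢
    obtain ⟨i, hx, hi⟩ := hx
    obtain ⟨j, hj⟩ := m.exists_mem_block (bne x i hx (hq2.trans hi))
    rw [← Compos.color_eq_some] at hj
    refine ⟨j, hj, hi.trans ?_⟩
    rw [← l.card_color, ← m.card_color]
    refine Finset.card_le_card_of_injOn b.1 ?_ ?_
    · intro y hy
      simp only [Finset.coe_filter, Finset.mem_univ, true_and, Set.mem_ofPred_eq] at hy ⊢
      rw [bcol x y i hx hy (hq2.trans hi), hj]
    · intro y hy z hz h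
      simp only [Finset.coe_filter, Finset.mem_univ, true_and, Set.mem_ofPred_eq] at hy hz
      exact binj y z i i hy (hq2.trans hi) hz (hq2.trans hi) h
  · intro y hy z hz h
    simp only [Finset.coe_filter, Finset.mem_univ, true_and, Set.mem_ofPred_eq] at hy hz
    obtain ⟨i, hy, hi⟩ := hy
    obtain ⟨j, hz, hj⟩ := hz
    exact binj y z i j hy (hq2.trans hi) hz (hq2.trans hj) h

end Divisibility

/-! ### Coordinates `(i, a, b)` on the points of a `p`-partition. -/

namespace Compos

variable {r n : ℕ}

/-- `x` is the `b`-th element of the `a`-th block of size `p ^ i`. -/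
def IsPt (p : ℕ) (l : Compos r n) (i : ℕ) (a : Fin (l.mult p i + 1)) (b : ℕ)
    (x : Fin (r + 1)) : Prop :=
  a ≠ 0 ∧ 1 ≤ b ∧ b ≤ p ^ i ∧ (x : ℕ) = l.offset p i + ((a : ℕ) - 1) * p ^ i + b

section

variable {p : ℕ} {l : Compos r n}

theorem above_eq_offset_add (p : ℕ) (l : Compos r n) (i : ℕ) :
    l.above (p ^ i) = l.offset p i + l.mult p i * p ^ i := by
  have : Finset.univ.filter (fun j => p ^ i ≤ l.1 j) =
      Finset.univ.filter (fun j => p ^ i < l.1 j) ∪ Finset.univ.filter (fun j => l.1 j = p ^ i) := by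
    ext j
    simp only [Finset.mem_filter, Finset.mem_univ, true_and, Finset.mem_union]
    omega
  rw [above, this, Finset.sum_union, offset, mult,
    Finset.sum_congr rfl fun j hj => (Finset.mem_filter.1 hj).2]
  · simp
  · rw [Finset.disjoint_filter]
    intro j _ h
    omega

/-- Every nonzero part is a power of `p`, so none lies strictly between `p ^ i` and `p ^ (i + 1)`.
-/
theorem above_succ_eq_offset (hp : p.Prime) (hlp : l.IsPPowers p) (i : ℕ) :
    l.above (p ^ (i + 1)) = l.offset p i := by
  rw [above, offset]
  congr 1
  ext j
  simp only [Finset.mem_filter, Finset.mem_univ, true_and]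
  obtain h | ⟨e, h⟩ := hlp j
  · rw [h]
    have := Nat.pow_pos (n := i + 1) hp.pos
    omega
  · rw [h, Nat.pow_le_pow_iff_right hp.one_lt, Nat.pow_lt_pow_iff_right hp.one_lt]
    omega

theorem above_antitone (l : Compos r n) : Antitone l.above := by
  intro q q' h
  refine Finset.sum_le_sum_of_subset fun j hj => ?_
  simp only [Finset.mem_filter, Finset.mem_univ, true_and] at hj ⊢
  omega

theorem IsPt.le_above {i : ℕ} {a : Fin (l.mult p i + 1)} {b : ℕ} {x : Fin (r + 1)}
    (h : l.IsPt p i a b x) : (x : ℕ) ≤ l.above (p ^ i) := by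
  obtain ⟨ha, hb, hb', hx⟩ := h
  rw [above_eq_offset_add, hx]
  have h1 : (a : ℕ) ≠ 0 := fun h => ha (Fin.ext h)
  have h2 : ((a : ℕ) - 1 + 1) * p ^ i ≤ l.mult p i * p ^ i :=
    Nat.mul_le_mul_right _ (by have := a.2; omega)
  rw [add_mul, one_mul] at h2
  omega

theorem IsPt.ne_zero {i : ℕ} {a : Fin (l.mult p i + 1)} {b : ℕ} {x : Fin (r + 1)}
    (h : l.IsPt p i a b x) : x ≠ 0 := by
  rintro rfl
  obtain ⟨ha, hb, hb', hx⟩ := h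
  rw [Fin.val_zero] at hx
  omega

theorem exists_pt {i : ℕ} {a : Fin (l.mult p i + 1)} {b : ℕ} (ha : a ≠ 0) (hb : 1 ≤ b)
    (hb' : b ≤ p ^ i) : ∃ x, l.IsPt p i a b x := by
  have h1 : (a : ℕ) ≠ 0 := fun h => ha (Fin.ext h)
  have h2 : ((a : ℕ) - 1 + 1) * p ^ i ≤ l.mult p i * p ^ i :=
    Nat.mul_le_mul_right _ (by have := a.2; omega)
  have h3 := l.above_le (p ^ i)
  rw [above_eq_offset_add] at h3
  rw [add_mul, one_mul] at h2
  exact ⟨⟨l.offset p i + ((a : ℕ) - 1) * p ^ i + b, by omega⟩, ha, hb, hb', rfl⟩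

theorem exists_isPt (hp : p.Prime) (hlp : l.IsPPowers p) {x : Fin (r + 1)} (hx : x ≠ 0) :
    ∃ i a b, l.IsPt p i a b x := by
  classical
  have hx1 : 1 ≤ (x : ℕ) := Nat.pos_of_ne_zero fun h => hx (Fin.ext h)
  have hex : ∃ i, l.above (p ^ i) < x := by
    refine ⟨r + 1, lt_of_le_of_lt ?_ hx1⟩
    rw [above]
    refine (Finset.sum_eq_zero fun j hj => ?_).le
    simp only [Finset.mem_filter, Finset.mem_univ, true_and] at hj
    have h1 := Nat.lt_pow_self hp.one_lt (n := r + 1)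
    have h2 : l.1 j ≤ r := by
      conv_rhs => rw [← l.2]
      exact Finset.single_le_sum (f := l.1) (fun _ _ => Nat.zero_le _) (Finset.mem_univ j)
    omega
  -- The values `above (p ^ i)` decrease with `i` from `r` to `0`. The first one below `x` has index
  -- one more than the level of `x`.
  obtain ⟨i, hi, hmin⟩ : ∃ i, l.above (p ^ i) < x ∧ ∀ i' < i, ¬ l.above (p ^ i') < x :=
    ⟨Nat.find hex, Nat.find_spec hex, fun _ => Nat.find_min hex⟩
  obtain _ | i := i
  · rw [pow_zero, l.above_of_le_one le_rfl] at hi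
    have := x.2
    omega
  have hi' := hmin i (Nat.lt_succ_self i)
  rw [above_succ_eq_offset hp hlp] at hi
  rw [above_eq_offset_add] at hi'
  have hpos : 0 < p ^ i := Nat.pow_pos hp.pos
  -- The zero-based position within the level: quotient and remainder modulo `p ^ i`, each shifted
  -- by one, give block number and place.
  set d := (x : ℕ) - l.offset p i - 1 with hd
  have hdlt : d / p ^ i < l.mult p i := (Nat.div_lt_iff_lt_mul hpos).2 (by omega)
  have hdm := Nat.div_add_mod d (p ^ i)
  have hml := Nat.mod_lt d hpos
  refine ⟨i, ⟨d / p ^ i + 1, by omega⟩, d % p ^ i + 1, ?_, Nat.succ_pos _, hml, ?_⟩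
  · intro h
    simpa using congrArg Fin.val h
  · simp only [Nat.add_sub_cancel]
    rw [mul_comm] at hdm
    omega

theorem IsPt.unique (hp : p.Prime) (hlp : l.IsPPowers p) {i i' : ℕ} {a : Fin (l.mult p i + 1)}
    {a' : Fin (l.mult p i' + 1)} {b b' : ℕ} {x : Fin (r + 1)} (h : l.IsPt p i a b x)
    (h' : l.IsPt p i' a' b' x) : i = i' ∧ (a : ℕ) = a' ∧ b = b' := by
  have key : ∀ {i i' : ℕ} {a : Fin (l.mult p i + 1)} {a' : Fin (l.mult p i' + 1)} {b b' : ℕ},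
      l.IsPt p i a b x → l.IsPt p i' a' b' x → ¬ i < i' := by
    intro i i' a a' b b' h h' hlt
    have h1 := h'.le_above
    have h2 := l.above_antitone (Nat.pow_le_pow_right hp.pos (Nat.succ_le_of_lt hlt))
    rw [Nat.succ_eq_add_one, above_succ_eq_offset hp hlp] at h2
    obtain ⟨_, hb, _, hx⟩ := h
    omega
  obtain rfl : i = i' := le_antisymm (not_lt.1 (key h' h)) (not_lt.1 (key h h'))
  obtain ⟨ha, hb1, hb2, hx⟩ := h
  obtain ⟨ha', hb1', hb2', hx'⟩ := h'
  have h1 : (a : ℕ) ≠ 0 := fun h => ha (Fin.ext h)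
  have h1' : (a' : ℕ) ≠ 0 := fun h => ha' (Fin.ext h)
  have e : ((a : ℕ) - 1) * p ^ i + (b - 1) = ((a' : ℕ) - 1) * p ^ i + (b' - 1) := by omega
  have hpos : 0 < p ^ i := Nat.pow_pos hp.pos
  have hd := congrArg (· / p ^ i) e
  rw [add_comm, Nat.add_mul_div_right _ _ hpos, add_comm, add_comm _ (b' - 1),
    Nat.add_mul_div_right _ _ hpos, Nat.div_eq_of_lt (by omega), Nat.div_eq_of_lt (by omega)] at hd
  have ha : (a : ℕ) = a' := by omega
  refine ⟨rfl, ha, ?_⟩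
  rw [ha] at e
  omega

theorem IsPt.eq {i : ℕ} {a : Fin (l.mult p i + 1)} {b : ℕ} {x y : Fin (r + 1)}
    (h : l.IsPt p i a b x) (h' : l.IsPt p i a b y) : x = y :=
  Fin.ext (h.2.2.2.trans h'.2.2.2.symm)

/-- As the parts decrease, those before `j` are all the strictly larger ones together with the
earlier ones of equal size. -/
theorem sum_Iio_eq (hl : l.IsPartition) {i : ℕ} {j : Fin n} (hj : l.1 j = p ^ i) :
    ∑ j' ∈ Finset.Iio j, l.1 j' =
      l.offset p i + ((Finset.Iio j).filter fun j' => l.1 j' = p ^ i).card * p ^ i := by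
  have : Finset.Iio j = Finset.univ.filter (fun j => p ^ i < l.1 j) ∪
      (Finset.Iio j).filter fun j' => l.1 j' = p ^ i := by
    ext j'
    simp only [Finset.mem_filter, Finset.mem_univ, true_and, Finset.mem_union, Finset.mem_Iio]
    constructor
    · intro h
      have := hl h.le
      omega
    · rintro (h | h)
      · by_contra h'
        have := hl (not_lt.1 h')
        omega
      · exact h.1
  rw [this, Finset.sum_union, offset, ← this,
    Finset.sum_congr rfl fun j hj => (Finset.mem_filter.1 hj).2]
  · simp
  · rw [Finset.disjoint_left]
    simp only [Finset.mem_filter, Finset.mem_univ, true_and, not_and]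
    intro j h
    omega

theorem exists_isPt_iff_color (hl : l.IsPartition) {i : ℕ} {j : Fin n} (hj : l.1 j = p ^ i) :
    ∃ a : Fin (l.mult p i + 1), ∀ x, l.color x = some j ↔ ∃ b, l.IsPt p i a b x := by
  have hlt : ((Finset.Iio j).filter fun j' => l.1 j' = p ^ i).card < l.mult p i := by
    refine Finset.card_lt_card ?_
    rw [Finset.ssubset_iff_of_subset]
    · exact ⟨j, by simp [hj], by simp⟩
    · exact Finset.filter_subset_filter _ (Finset.subset_univ _)
  refine ⟨⟨((Finset.Iio j).filter fun j' => l.1 j' = p ^ i).card + 1, by omega⟩, fun x => ?_⟩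
  rw [color_eq_some]
  change _ < _ ∧ _ ≤ _ ↔ _
  rw [sum_Iic_eq, sum_Iio_eq hl hj, hj]
  simp only [IsPt, Nat.add_sub_cancel]
  constructor
  · rintro ⟨h1, h2⟩
    refine ⟨(x : ℕ) - (l.offset p i +
      ((Finset.Iio j).filter fun j' => l.1 j' = p ^ i).card * p ^ i), ?_, by omega, by omega,
      by omega⟩
    intro h
    simpa using congrArg Fin.val h
  · rintro ⟨b, _, h1, h2, h3⟩
    omega

theorem IsPt.exists_color (hp : p.Prime) (hl : l.IsPartition) (hlp : l.IsPPowers p) {i : ℕ}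
    {a : Fin (l.mult p i + 1)} {b : ℕ} {x : Fin (r + 1)} (h : l.IsPt p i a b x) :
    ∃ j, l.1 j = p ^ i ∧ ∀ y, l.color y = some j ↔ ∃ b, l.IsPt p i a b y := by
  obtain ⟨j, hj⟩ := l.exists_mem_block h.ne_zero
  rw [← color_eq_some] at hj
  obtain h0 | ⟨e, he⟩ := hlp j
  · have hx := l.color_eq_some.1 hj
    have := l.sum_Iic_eq j
    have := hx.1
    have := hx.2
    omega
  obtain ⟨a', ha'⟩ := exists_isPt_iff_color hl he
  obtain ⟨b', hb'⟩ := (ha' x).1 hj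
  obtain ⟨rfl, haa, -⟩ := h.unique hp hlp hb'
  obtain rfl := Fin.ext haa
  exact ⟨j, he, ha'⟩

end

end Compos

/-! ### The maps `φ_l` and the large blocks. -/

namespace Compos

variable {r n : ℕ} {p : ℕ} {l : Compos r n}

/-- Every nonzero point has unique coordinates, so the prescribed values are consistent. -/
theorem exists_isPhi (hp : p.Prime) (hlp : l.IsPPowers p)
    (α : ∀ i, Function.End (Fin (l.mult p i + 1))) : ∃ β, l.IsPhi p α β := by
  classical
  have H : ∀ x : Fin (r + 1), ∃ y : Fin (r + 1), (x = 0 → y = 0) ∧ ∀ i a b, l.IsPt p i a b x →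
      (y : ℕ) = if α i a = 0 then 0 else l.offset p i + ((α i a : ℕ) - 1) * p ^ i + b := by
    intro x
    by_cases hx : x = 0
    · exact ⟨0, fun _ => rfl, fun i a b h => absurd hx h.ne_zero⟩
    · obtain ⟨i, a, b, h⟩ := exists_isPt hp hlp hx
      obtain ⟨y, hy⟩ : ∃ y : Fin (r + 1), (y : ℕ) =
          if α i a = 0 then 0 else l.offset p i + ((α i a : ℕ) - 1) * p ^ i + b := by
        split_ifs with h0
        · exact ⟨0, rfl⟩
        · obtain ⟨y, hy⟩ := exists_pt h0 h.2.1 h.2.2.1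
          exact ⟨y, hy.2.2.2⟩
      refine ⟨y, fun h => absurd h hx, fun i' a' b' h' => ?_⟩
      obtain ⟨rfl, haa, rfl⟩ := h.unique hp hlp h'
      obtain rfl := Fin.ext haa
      exact hy
  choose β hβ hβ' using H
  exact ⟨β, hβ 0 rfl, fun i a b x ha hb hb' hx => hβ' x i a b ⟨ha, hb, hb', hx⟩⟩

section IsPhi

variable {α α' : ∀ i, Function.End (Fin (l.mult p i + 1))} {β β' : Function.End (Fin (r + 1))}

theorem IsPhi.eq_zero (h : l.IsPhi p α β) {i : ℕ} {a : Fin (l.mult p i + 1)} {b : ℕ}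
    {x : Fin (r + 1)} (hx : l.IsPt p i a b x) (h0 : α i a = 0) : β x = 0 := by
  have := h.2 i a b x hx.1 hx.2.1 hx.2.2.1 hx.2.2.2
  rw [if_pos h0] at this
  exact Fin.ext this

theorem IsPhi.isPt (h : l.IsPhi p α β) {i : ℕ} {a : Fin (l.mult p i + 1)} {b : ℕ}
    {x : Fin (r + 1)} (hx : l.IsPt p i a b x) (h0 : α i a ≠ 0) : l.IsPt p i (α i a) b (β x) := by
  have := h.2 i a b x hx.1 hx.2.1 hx.2.2.1 hx.2.2.2
  rw [if_neg h0] at this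
  exact ⟨h0, hx.2.1, hx.2.2.1, this⟩

theorem IsPhi.eq_zero_iff (h : l.IsPhi p α β) {i : ℕ} {a : Fin (l.mult p i + 1)} {b : ℕ}
    {x : Fin (r + 1)} (hx : l.IsPt p i a b x) : β x = 0 ↔ α i a = 0 :=
  ⟨fun h' => by_contra fun h0 => (h.isPt hx h0).ne_zero h', h.eq_zero hx⟩

/-- Agreement is only asked at `a ≠ 0`, since `IsPhi` does not constrain `α i 0`. -/
theorem IsPhi.ext (hp : p.Prime) (hlp : l.IsPPowers p) (h : l.IsPhi p α β) (h' : l.IsPhi p α' β')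
    (hα : ∀ i a, a ≠ 0 → α i a = α' i a) : β = β' := by
  funext x
  by_cases hx : x = 0
  · rw [hx, h.1, h'.1]
  · obtain ⟨i, a, b, hx⟩ := exists_isPt hp hlp hx
    by_cases h0 : α i a = 0
    · rw [h.eq_zero hx h0, h'.eq_zero hx (hα i a hx.1 ▸ h0)]
    · have := h'.isPt hx (hα i a hx.1 ▸ h0)
      rw [← hα i a hx.1] at this
      exact (h.isPt hx h0).eq this

theorem IsPhi.inj (hp : p.Prime) (hlp : l.IsPPowers p) (h : l.IsPhi p α β) (h' : l.IsPhi p α' β)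
    {i : ℕ} {a : Fin (l.mult p i + 1)} (ha : a ≠ 0) : α i a = α' i a := by
  obtain ⟨x, hx⟩ := exists_pt (p := p) ha le_rfl (Nat.one_le_pow i p hp.pos)
  by_cases h0 : α i a = 0
  · rw [h0, eq_comm, ← h'.eq_zero_iff hx, h.eq_zero_iff hx, h0]
  · have h0' : α' i a ≠ 0 := by rwa [Ne, ← h'.eq_zero_iff hx, h.eq_zero_iff hx]
    exact Fin.ext ((h.isPt hx h0).unique hp hlp (h'.isPt hx h0')).2.1

theorem isPhi_one : l.IsPhi p (fun _ => 1) 1 := by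
  refine ⟨rfl, fun i a b x ha _ _ hx => ?_⟩
  change (x : ℕ) = if a = 0 then 0 else _
  rw [if_neg ha, hx]
  rfl

/-- The condition on `α` is needed because a block sent to `0` by `α'` must stay at `0`. -/
theorem IsPhi.mul (h : l.IsPhi p α β) (h' : l.IsPhi p α' β') (h0 : ∀ i, α i 0 = 0) :
    l.IsPhi p (fun i => α i * α' i) (β * β') := by
  refine ⟨?_, fun i a b x ha hb hb' hx => ?_⟩
  · change β (β' 0) = 0
    rw [h'.1, h.1]
  have hx : l.IsPt p i a b x := ⟨ha, hb, hb', hx⟩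
  change (β (β' x) : ℕ) = if α i (α' i a) = 0 then 0 else
    l.offset p i + ((α i (α' i a) : ℕ) - 1) * p ^ i + b
  by_cases h1 : α' i a = 0
  · rw [h1, h0, if_pos rfl, h'.eq_zero hx h1, h.1]
    rfl
  · have hx' := h'.isPt hx h1
    exact h.2 i _ b _ h1 hx'.2.1 hx'.2.2.1 hx'.2.2.2

end IsPhi

/-- The union of the blocks with at least two elements. -/
def large (l : Compos r n) : Set (Fin (r + 1)) := {x | ∃ i, l.color x = some i ∧ 2 ≤ l.1 i}

theorem mem_large_of_color {x y : Fin (r + 1)} (h : l.color x = l.color y) :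
    x ∈ l.large ↔ y ∈ l.large := by
  simp only [large, Set.mem_ofPred_eq, h]

theorem ne_zero_of_mem_large {x : Fin (r + 1)} (h : x ∈ l.large) : x ≠ 0 := by
  rintro rfl
  obtain ⟨i, hi, _⟩ := h
  simp [color_zero] at hi

theorem IsPt.mem_large_iff (hp : p.Prime) (hl : l.IsPartition) (hlp : l.IsPPowers p) {i : ℕ}
    {a : Fin (l.mult p i + 1)} {b : ℕ} {x : Fin (r + 1)} (h : l.IsPt p i a b x) :
    x ∈ l.large ↔ 0 < i := by
  obtain ⟨j, hj, hj'⟩ := h.exists_color hp hl hlp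
  have hx := (hj' x).2 ⟨b, h⟩
  constructor
  · rintro ⟨j', h', h2⟩
    rw [hx, Option.some_inj] at h'
    subst h'
    rcases Nat.eq_zero_or_pos i with rfl | hi
    · rw [hj, pow_zero] at h2
      omega
    · exact hi
  · intro hi
    refine ⟨j, hx, ?_⟩
    rw [hj]
    exact hp.two_le.trans (Nat.le_self_pow hi.ne' p)

theorem IsPt.color_eq_iff (hp : p.Prime) (hl : l.IsPartition) (hlp : l.IsPPowers p) {i : ℕ}
    {a : Fin (l.mult p i + 1)} {b : ℕ} {x y : Fin (r + 1)} (h : l.IsPt p i a b x) :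
    l.color y = l.color x ↔ ∃ b, l.IsPt p i a b y := by
  obtain ⟨j, hj, hj'⟩ := h.exists_color hp hl hlp
  rw [(hj' x).2 ⟨b, h⟩, hj']

theorem eq_of_color_eq_of_notMem_large {x y : Fin (r + 1)} (hx : x ∉ l.large)
    (h : l.color y = l.color x) : y = x := by
  classical
  by_cases h0 : x = 0
  · rwa [h0, color_zero, color_eq_none, ← h0] at h
  obtain ⟨i, hi⟩ := l.exists_mem_block h0
  rw [← color_eq_some] at hi
  by_contra hne
  refine hx ⟨i, hi, ?_⟩
  rw [← card_color]
  exact Finset.one_lt_card.2 ⟨y, by simp [h, hi], x, by simp [hi], hne⟩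

end Compos

/-! ### Elements of `leftMonoid` and their double cosets. -/

section Young

variable {r n : ℕ} {S : Submonoid (Function.End (Fin (r + 1)))} {l : Compos r n}

/-- Two maps which agree up to permutations inside the large blocks differ by an element of
the Young subgroup. -/
theorem exists_young_mul_eq (hsym : sym r ≤ S) {α β : Function.End (Fin (r + 1))}
    (hα : Set.InjOn α l.large) (hβ : Set.InjOn β l.large)
    (hm : ∀ x ∈ l.large, α x ∈ l.large)
    (hc : ∀ x ∈ l.large, l.color (β x) = l.color (α x))
    (hs : ∀ x ∉ l.large, β x = α x ∧ α x ∉ l.large) :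
    ∃ σ ∈ l.young S, ∀ x, (σ : S).1 (α x) = β x := by
  classical
  -- By finiteness `α` permutes the large points, so `α x ↦ β x` is defined on all of them; `σ`
  -- extends it by the identity.
  have hbij := (l.large.toFinite.injOn_iff_bijOn_of_mapsTo hm).1 hα
  have hinv : ∀ y, ∃ z, (y ∈ l.large → ∃ x ∈ l.large, α x = y ∧ z = β x) ∧
      (y ∉ l.large → z = y) := by
    intro y
    by_cases hy : y ∈ l.large
    · obtain ⟨x, hx, rfl⟩ := hbij.surjOn hy
      exact ⟨β x, fun _ => ⟨x, hx, rfl, rfl⟩, fun h => absurd hy h⟩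
    · exact ⟨y, fun h => absurd h hy, fun _ => rfl⟩
  choose σ hσ hσ' using hinv
  have hcol : ∀ y, l.color (σ y) = l.color y := by
    intro y
    by_cases hy : y ∈ l.large
    · obtain ⟨x, hx, e, e'⟩ := hσ y hy
      rw [e', hc x hx, e]
    · rw [hσ' y hy]
  have hinj : Function.Injective σ := by
    intro y y' h
    have hyy : y ∈ l.large ↔ y' ∈ l.large :=
      Compos.mem_large_of_color (by rw [← hcol, h, hcol])
    by_cases hy : y ∈ l.large
    · obtain ⟨x, hx, e, e'⟩ := hσ y hy
      obtain ⟨x', hx', f, f'⟩ := hσ y' (hyy.1 hy)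
      rw [← e, ← f, hβ hx hx' (by rw [← e', ← f', h])]
    · rwa [hσ' y hy, hσ' y' (mt hyy.2 hy)] at h
  have hbij' := Finite.injective_iff_bijective.1 hinj
  have h0 : σ 0 = 0 := by rw [← l.color_eq_none, hcol, l.color_zero]
  refine ⟨permUnit hsym (Equiv.ofBijective σ hbij') h0, (permUnit_mem_young hsym).2 hcol,
    fun x => ?_⟩
  change σ (α x) = β x
  by_cases hx : x ∈ l.large
  · obtain ⟨x', hx', e, e'⟩ := hσ _ (hm x hx)
    rw [e', hα hx' hx e]
  · rw [hσ' _ (hs x hx).2, (hs x hx).1]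

variable {p : ℕ}

section LeftMonoid

variable {β : Function.End (Fin (r + 1))}

theorem leftMonoid_mem_large_iff (hp : p.Prime) (hl : l.IsPartition) (hlp : l.IsPPowers p)
    (hβ : β ∈ l.leftMonoid S p) (x : Fin (r + 1)) : β x ∈ l.large ↔ x ∈ l.large := by
  obtain ⟨_, α, h0, h1, h2⟩ := hβ
  by_cases hx0 : x = 0
  · rw [hx0, h2.1]
  obtain ⟨i, a, b, hx⟩ := Compos.exists_isPt hp hlp hx0
  rw [hx.mem_large_iff hp hl hlp]
  by_cases hα : α i a = 0
  · rw [h2.eq_zero hx hα]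
    refine ⟨fun h => absurd rfl (Compos.ne_zero_of_mem_large h), fun hi => ?_⟩
    exact absurd ((h1 i hi).2.1 (hα.trans (h1 i hi).1.symm)) hx.1
  · exact (h2.isPt hx hα).mem_large_iff hp hl hlp

theorem leftMonoid_injOn (hp : p.Prime) (hl : l.IsPartition) (hlp : l.IsPPowers p)
    (hβ : β ∈ l.leftMonoid S p) : Set.InjOn β l.large := by
  intro x hx y hy h
  have hx' := (leftMonoid_mem_large_iff hp hl hlp hβ x).2 hx
  obtain ⟨_, α, h0, h1, h2⟩ := hβ
  obtain ⟨i, a, b, hxp⟩ := Compos.exists_isPt hp hlp (Compos.ne_zero_of_mem_large hx)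
  obtain ⟨i', a', b', hyp⟩ := Compos.exists_isPt hp hlp (Compos.ne_zero_of_mem_large hy)
  have hn := Compos.ne_zero_of_mem_large hx'
  have e1 := h2.isPt hxp (mt (h2.eq_zero hxp) hn)
  have e2 := h2.isPt hyp (mt (h2.eq_zero hyp) (h ▸ hn))
  rw [← h] at e2
  obtain ⟨rfl, ha, rfl⟩ := e1.unique hp hlp e2
  obtain rfl := (h1 i ((hxp.mem_large_iff hp hl hlp).1 hx)).2.1 (Fin.ext ha)
  exact hxp.eq hyp

theorem leftMonoid_color_eq (hp : p.Prime) (hl : l.IsPartition) (hlp : l.IsPPowers p)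
    (hβ : β ∈ l.leftMonoid S p) {x y : Fin (r + 1)} (h : l.color y = l.color x) :
    l.color (β y) = l.color (β x) := by
  obtain ⟨_, α, h0, h1, h2⟩ := hβ
  by_cases hx0 : x = 0
  · rw [hx0, l.color_zero, l.color_eq_none] at h
    rw [hx0, h]
  obtain ⟨i, a, b, hx⟩ := Compos.exists_isPt hp hlp hx0
  obtain ⟨b', hy⟩ := (hx.color_eq_iff hp hl hlp).1 h
  by_cases hα : α i a = 0
  · rw [h2.eq_zero hx hα, h2.eq_zero hy hα]
  · exact ((h2.isPt hx hα).color_eq_iff hp hl hlp).2 ⟨b', h2.isPt hy hα⟩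

/-- Both `β` and `β π` are injective on large points, send each point into the same block, and agree
on the singleton blocks; `exists_young_mul_eq` compares them. Thus `β` normalizes the Young subgroup
from one side. -/
theorem leftMonoid_mul_young (hp : p.Prime) (hl : l.IsPartition) (hlp : l.IsPPowers p)
    (hsym : sym r ≤ S) {β : S} (hβ : β.1 ∈ l.leftMonoid S p) {π : (S)ˣ} (hπ : π ∈ l.young S) :
    ∃ σ ∈ l.young S, β * (π : S) = (σ : S) * β := by
  have hπ' := mem_young.1 hπ
  have hinj : Set.InjOn (β * (π : S)).1 l.large := by
    intro x hx y hy h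
    exact unit_injective π (leftMonoid_injOn hp hl hlp hβ
      ((Compos.mem_large_of_color (hπ' x)).2 hx) ((Compos.mem_large_of_color (hπ' y)).2 hy) h)
  obtain ⟨σ, hσ, h⟩ := exists_young_mul_eq hsym (leftMonoid_injOn hp hl hlp hβ) hinj
    (fun x hx => (leftMonoid_mem_large_iff hp hl hlp hβ x).2 hx)
    (fun x _ => leftMonoid_color_eq hp hl hlp hβ (hπ' x))
    (fun x hx => ⟨congrArg β.1 (Compos.eq_of_color_eq_of_notMem_large hx (hπ' x)),
      mt (leftMonoid_mem_large_iff hp hl hlp hβ x).1 hx⟩)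
  exact ⟨σ, hσ, Subtype.ext (funext fun x => (h x).symm)⟩

theorem nL_leftMonoid (hp : p.Prime) (hl : l.IsPartition) (hlp : l.IsPPowers p)
    (hsym : sym r ≤ S) {β : S} (hβ : β.1 ∈ l.leftMonoid S p) :
    nL (dc (fun l : Compos r n => l.young S) l l β) = Nat.card (l.young S) := by
  rw [nL_dc]
  refine Nat.card_congr (Equiv.subtypeEquivRight fun π => ?_)
  rw [mem_stabL]
  exact ⟨fun h => h.1, fun h => ⟨h, leftMonoid_mul_young hp hl hlp hsym hβ h⟩⟩

/-- The double coset is a single left coset, so `β x` and `β' x` lie in the same block; both keep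
the place of `x` within its block, so they coincide. -/
theorem leftMonoid_dc_inj (hp : p.Prime) (hl : l.IsPartition) (hlp : l.IsPPowers p)
    (hsym : sym r ≤ S) {β β' : S} (hβ : β.1 ∈ l.leftMonoid S p) (hβ' : β'.1 ∈ l.leftMonoid S p)
    (h : dc (fun l : Compos r n => l.young S) l l β = dc _ l l β') : β = β' := by
  obtain ⟨σ, hσ, π, hπ, e⟩ := dc_eq_iff.1 h
  obtain ⟨τ, hτ, e'⟩ := leftMonoid_mul_young hp hl hlp hsym hβ hπ
  rw [mul_assoc, e', ← mul_assoc] at e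
  have hcol : ∀ x, l.color (β'.1 x) = l.color (β.1 x) := by
    intro x
    rw [← e]
    exact mem_young.1 (mul_mem hσ hτ) _
  obtain ⟨_, α, h0, h1, h2⟩ := hβ
  obtain ⟨_, α', h0', h1', h2'⟩ := hβ'
  refine Subtype.ext (funext fun x => ?_)
  by_cases hx0 : x = 0
  · rw [hx0, h2.1, h2'.1]
  obtain ⟨i, a, b, hx⟩ := Compos.exists_isPt hp hlp hx0
  have hz : β'.1 x = 0 ↔ β.1 x = 0 := by
    rw [← l.color_eq_none, hcol, l.color_eq_none]
  by_cases hα : β.1 x = 0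
  · rw [hα, hz.2 hα]
  · have e1 := h2.isPt hx (mt (h2.eq_zero hx) hα)
    have e2 := h2'.isPt hx (mt (h2'.eq_zero hx) (mt hz.1 hα))
    obtain ⟨b', e3⟩ := (e1.color_eq_iff hp hl hlp).1 (hcol x)
    obtain ⟨-, ha, -⟩ := e2.unique hp hlp e3
    rw [Fin.ext ha] at e2
    exact e1.eq e2

end LeftMonoid

end Young

/-! ### Basis elements outside the ideal are represented in `leftMonoid`. -/

theorem Compos.exists_ne_of_mem_large {r n : ℕ} {l : Compos r n} {y : Fin (r + 1)}
    (hy : y ∈ l.large) : ∃ y', l.color y' = l.color y ∧ y' ≠ y := by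
  classical
  obtain ⟨i, hi, h2⟩ := hy
  rw [← card_color] at h2
  obtain ⟨y', h', hne⟩ := Finset.exists_mem_ne h2 y
  exact ⟨y', by simpa [hi] using h', hne⟩

section Representative

variable {r n p : ℕ} {S : Submonoid (Function.End (Fin (r + 1)))} {l : Compos r n}

/-- A map which carries blocks to blocks, large blocks being permuted, has the same double coset as
an element of `leftMonoid`. -/
theorem exists_leftMonoid_dc_eq (hp : p.Prime) (hl : l.IsPartition) (hlp : l.IsPPowers p)
    (hsym : sym r ≤ S) (hS : S ≤ tauBar r) (α : S)
    (hsurj : ∀ x y, l.color y = l.color (α.1 x) → ∃ x', l.color x' = l.color x ∧ α.1 x' = y)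
    (hcol : ∀ x x', l.color x' = l.color x → l.color (α.1 x') = l.color (α.1 x))
    (hinj : Set.InjOn α.1 l.large) (hlarge : ∀ x, α.1 x ∈ l.large ↔ x ∈ l.large) :
    ∃ β : S, β.1 ∈ l.leftMonoid S p ∧
      dc (fun l : Compos r n => l.young S) l l α = dc _ l l β := by
  have hα0 : α.1 0 = 0 := unit_map_zero hS α
  -- A large block is mapped bijectively onto a block, which therefore has the same size; singleton
  -- blocks not sent to `0` go to singleton blocks.
  have hlevel : ∀ {i a b x}, l.IsPt p i a b x → α.1 x ≠ 0 → ∃ a' b', l.IsPt p i a' b' (α.1 x) := by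
    intro i a b x hx h0
    obtain ⟨i', a', b', hx'⟩ := Compos.exists_isPt hp hlp h0
    have hi : (0 < i') ↔ 0 < i := by
      rw [← hx'.mem_large_iff hp hl hlp, hlarge, hx.mem_large_iff hp hl hlp]
    rcases Nat.eq_zero_or_pos i with rfl | hi0
    · obtain rfl : i' = 0 := by omega
      exact ⟨a', b', hx'⟩
    obtain ⟨j, hj, hj'⟩ := hx.exists_color hp hl hlp
    obtain ⟨j', hk, hk'⟩ := hx'.exists_color hp hl hlp
    have hxj := (hj' _).2 ⟨b, hx⟩
    have hxk := (hk' _).2 ⟨b', hx'⟩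
    have himg : α.1 '' {z | l.color z = some j} = {z | l.color z = some j'} := by
      ext z
      simp only [Set.mem_ofPred_eq]
      constructor
      · rintro ⟨w, hw, rfl⟩
        rw [hcol x w (hw.trans hxj.symm), hxk]
      · intro hz
        obtain ⟨w, hw, e⟩ := hsurj x z (hz.trans hxk.symm)
        exact ⟨w, hw.trans hxj, e⟩
    have hsub : {z | l.color z = some j} ⊆ l.large := fun z hz =>
      (Compos.mem_large_of_color (hxj.trans hz.symm)).1 ((hx.mem_large_iff hp hl hlp).2 hi0)
    have := (hinj.mono hsub).ncard_image
    rw [himg, ncard_color, ncard_color, hj, hk] at this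
    obtain rfl := Nat.pow_right_injective hp.two_le this
    exact ⟨a', b', hx'⟩
  -- The map induced by `α` on the set of blocks of size `p ^ i`, with `0` for a block that is sent
  -- to `0`.
  have hex : ∀ i (a : Fin (l.mult p i + 1)), ∃ a' : Fin (l.mult p i + 1), (a = 0 → a' = 0) ∧
      ∀ b x, l.IsPt p i a b x → (α.1 x = 0 → a' = 0) ∧
        (α.1 x ≠ 0 → ∃ b', l.IsPt p i a' b' (α.1 x)) := by
    intro i a
    by_cases ha : a = 0
    · exact ⟨0, fun _ => rfl, fun b x hx => absurd ha hx.1⟩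
    obtain ⟨x₁, hx₁⟩ := Compos.exists_pt (p := p) ha le_rfl (Nat.one_le_pow i p hp.pos)
    have hc : ∀ b x, l.IsPt p i a b x → l.color (α.1 x) = l.color (α.1 x₁) := fun b x hx =>
      hcol _ _ ((hx₁.color_eq_iff hp hl hlp).2 ⟨b, hx⟩)
    have hz : ∀ b x, l.IsPt p i a b x → (α.1 x = 0 ↔ α.1 x₁ = 0) := fun b x hx => by
      rw [← l.color_eq_none, hc b x hx, l.color_eq_none]
    by_cases h0 : α.1 x₁ = 0
    · exact ⟨0, fun _ => rfl, fun b x hx => ⟨fun _ => rfl, fun h => absurd ((hz b x hx).2 h0) h⟩⟩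
    · obtain ⟨a', b', h'⟩ := hlevel hx₁ h0
      exact ⟨a', fun h => absurd h ha, fun b x hx => ⟨fun h => absurd ((hz b x hx).1 h) h0,
        fun _ => (h'.color_eq_iff hp hl hlp).1 (hc b x hx)⟩⟩
  choose A hA0 hA using hex
  obtain ⟨β, hβ⟩ := Compos.exists_isPhi hp hlp A
  have hAsym : ∀ i, 0 < i → A i ∈ sym (l.mult p i) := by
    intro i hi
    have hpt : ∀ a : Fin (l.mult p i + 1), a ≠ 0 → ∃ b x b', l.IsPt p i a b x ∧ x ∈ l.large ∧
        l.IsPt p i (A i a) b' (α.1 x) := by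
      intro a ha
      obtain ⟨x, hx⟩ := Compos.exists_pt (p := p) ha le_rfl (Nat.one_le_pow i p hp.pos)
      have hxl := (hx.mem_large_iff hp hl hlp).2 hi
      obtain ⟨b', h'⟩ := (hA i a 1 x hx).2 (Compos.ne_zero_of_mem_large ((hlarge x).2 hxl))
      exact ⟨1, x, b', hx, hxl, h'⟩
    have hne : ∀ a : Fin (l.mult p i + 1), a ≠ 0 → A i a ≠ 0 := by
      intro a ha
      obtain ⟨_, _, _, _, _, h⟩ := hpt a ha
      exact h.1
    have hAinj : Function.Injective (A i) := by
      intro a a' h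
      by_cases ha : a = 0
      · by_contra hne'
        refine hne a' (fun h' => hne' (ha.trans h'.symm)) ?_
        rw [← h, hA0 i a ha]
      by_cases ha' : a' = 0
      · exact absurd (h.trans (hA0 i a' ha')) (hne a ha)
      obtain ⟨b, x, c, h1, h2, h3⟩ := hpt a ha
      obtain ⟨b', x', c', h1', h2', h3'⟩ := hpt a' ha'
      rw [← h] at h3'
      -- If two blocks had the same image, `α x'` would also be hit from the first block, against
      -- injectivity on large points.
      obtain ⟨x'', hx'', e⟩ := hsurj x (α.1 x') ((h3.color_eq_iff hp hl hlp).2 ⟨c', h3'⟩)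
      obtain rfl := hinj ((Compos.mem_large_of_color hx'').2 h2) h2' e
      obtain ⟨d, hd⟩ := (h1.color_eq_iff hp hl hlp).1 hx''
      exact Fin.ext (hd.unique hp hlp h1').2.1
    exact ⟨hA0 i 0 rfl, Finite.injective_iff_bijective.1 hAinj⟩
  have hAtau : A 0 ∈ tauBar (l.mult p 0) := hA0 0 0 rfl
  -- That `β ∈ S` is not yet known, so the monoid of all maps is used; membership follows afterwards
  -- from `β = σ α`.
  have hβtop : β ∈ l.leftMonoid ⊤ p := ⟨trivial, A, hAtau, hAsym, hβ⟩
  obtain ⟨σ, hσ, hσα⟩ := exists_young_mul_eq hsym hinj (leftMonoid_injOn hp hl hlp hβtop)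
    (fun x hx => (hlarge x).2 hx)
    (fun x hx => by
      obtain ⟨i, a, b, hxp⟩ := Compos.exists_isPt hp hlp (Compos.ne_zero_of_mem_large hx)
      obtain ⟨b', h'⟩ := (hA i a b x hxp).2 (Compos.ne_zero_of_mem_large ((hlarge x).2 hx))
      exact (h'.color_eq_iff hp hl hlp).2 ⟨b, hβ.isPt hxp h'.1⟩)
    (fun x hx => by
      refine ⟨?_, mt (hlarge x).1 hx⟩
      by_cases hx0 : x = 0
      · rw [hx0, hα0, hβ.1]
      obtain ⟨i, a, b, hxp⟩ := Compos.exists_isPt hp hlp hx0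
      obtain rfl : i = 0 := Nat.eq_zero_of_not_pos (mt (hxp.mem_large_iff hp hl hlp).2 hx)
      by_cases h0 : α.1 x = 0
      · rw [h0, hβ.eq_zero hxp ((hA 0 a b x hxp).1 h0)]
      · obtain ⟨b', h'⟩ := (hA 0 a b x hxp).2 h0
        have e := hβ.isPt hxp h'.1
        obtain rfl : b = b' := by
          have h1 := e.2.1
          have h2 := e.2.2.1
          have h3 := h'.2.1
          have h4 := h'.2.2.1
          rw [pow_zero] at h2 h4
          omega
        exact e.eq h')
  have hmul : ((σ : S) * α).1 = β := funext hσα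
  refine ⟨(σ : S) * α, ?_, ?_⟩
  · rw [hmul]
    exact ⟨hmul ▸ ((σ : S) * α).2, A, hAtau, hAsym, hβ⟩
  · rw [← dc_mul_mul hσ (one_mem (l.young S)) α]
    simp

/-- A basis element `f(l, α, l)` is in the ideal unless its double coset meets `leftMonoid`. -/
theorem f_mem_span_or_exists_leftMonoid (k : Type*) [Field k] (hp : p.Prime) (hrn : r ≤ n)
    (hl : l.IsPartition) (hlp : l.IsPPowers p) (hsym : sym r ≤ S) (hS : S ≤ tauBar r) (α : S) :
    LAlg.f k l l (dc (fun l : Compos r n => l.young S) l l α) ∈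
      TwoSidedIdeal.span {eBelow k S l} ∨
    ∃ β : S, β.1 ∈ l.leftMonoid S p ∧
      dc (fun l : Compos r n => l.young S) l l α = dc _ l l β := by
  classical
  refine or_iff_not_imp_left.2 fun hJ => ?_
  have hα0 : α.1 0 = 0 := unit_map_zero hS α
  have eapp : ∀ {π σ : (S)ˣ}, α * (π : S) = (σ : S) * α →
      ∀ x, α.1 ((π : S).1 x) = (σ : S).1 (α.1 x) := fun e x => congrFun (congrArg Subtype.val e) x
  -- Target splitting, with `Z` the part of the block of `α x` that is covered by the image of the
  -- block of `x`.
  have hsurj : ∀ x y, l.color y = l.color (α.1 x) →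
      ∃ x', l.color x' = l.color x ∧ α.1 x' = y := by
    intro x y hy
    by_cases h0 : α.1 x = 0
    · rw [h0, l.color_zero, l.color_eq_none] at hy
      exact ⟨x, rfl, h0.trans hy.symm⟩
    by_contra hcon
    refine hJ (f_mem_span_of_target k hrn hsym l
      {z | l.color z = l.color (α.1 x) ∧ ∃ x', l.color x' = l.color x ∧ α.1 x' = z}
      (y := α.1 x) (y' := y) ⟨rfl, x, rfl, rfl⟩ (fun h => hcon h.2) hy.symm h0
      (fun z hz => hz.1) α fun π hπ σ hσ e => ⟨σ, hσ, fun z => ?_, e⟩)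
    have e' := eapp e
    simp only [Set.mem_ofPred_eq, mem_young.1 hσ]
    refine and_congr_right fun _ => ⟨?_, ?_⟩
    · rintro ⟨x', hx', h⟩
      refine ⟨(π⁻¹ : (S)ˣ).1.1 x', (mem_young.1 (inv_mem hπ) x').trans hx', ?_⟩
      refine unit_injective σ ?_
      rw [← e', unit_apply_inv, h]
    · rintro ⟨x', hx', rfl⟩
      exact ⟨(π : S).1 x', (mem_young.1 hπ x').trans hx', e' x'⟩
  -- Target splitting with `Z = {y}`: if the image of `α` misses the block of `y`, then `σ` may be
  -- changed freely on that block, and a transposition makes it fix `y`.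
  have hmeet : ∀ y ∈ l.large, ∃ x, l.color (α.1 x) = l.color y := by
    intro y hy
    obtain ⟨y', hy', hne⟩ := Compos.exists_ne_of_mem_large hy
    have hy0 := Compos.ne_zero_of_mem_large hy
    by_contra! hcon
    refine hJ (f_mem_span_of_target k hrn hsym l {y} rfl hne hy'.symm hy0
      (fun z hz => by rw [Set.mem_singleton_iff.1 hz]) α fun π hπ σ hσ e => ?_)
    have hσ' := mem_young.1 hσ
    have hσ0 : (σ : S).1 y ≠ 0 := by
      rw [Ne, ← l.color_eq_none, hσ', l.color_eq_none]
      exact hy0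
    let τ := permUnit hsym (Equiv.swap y ((σ : S).1 y))
      (Equiv.swap_apply_of_ne_of_ne hy0.symm hσ0.symm)
    have hτ : τ ∈ l.young S := by
      refine (permUnit_mem_young hsym).2 fun z => ?_
      rw [Equiv.swap_apply_def]
      split_ifs with h1 h2
      · rw [h1, hσ']
      · rw [h2, hσ']
      · rfl
    have hτσ : ((τ * σ : (S)ˣ) : S).1 y = y := Equiv.swap_apply_right y _
    refine ⟨τ * σ, mul_mem hτ hσ, fun x => ?_, Subtype.ext (funext fun x => ?_)⟩
    · rw [Set.mem_singleton_iff, Set.mem_singleton_iff]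
      exact ⟨fun h => unit_injective (τ * σ) (h.trans hτσ.symm), fun h => by rw [h, hτσ]⟩
    · change α.1 ((π : S).1 x) = Equiv.swap y ((σ : S).1 y) ((σ : S).1 (α.1 x))
      rw [eapp e, Equiv.swap_apply_of_ne_of_ne]
      · intro h
        exact hcon x (by rw [← hσ', h])
      · intro h
        exact hcon x (by rw [unit_injective σ h])
  -- Source splitting, with `Z` the points of the block of `x` that `α` sends into the block of `α
  -- x`.
  have hcol : ∀ x x', l.color x' = l.color x → l.color (α.1 x') = l.color (α.1 x) := by
    intro x x' hx
    by_contra hcon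
    have hx0 : x ≠ 0 := by
      rintro rfl
      rw [l.color_zero, l.color_eq_none] at hx
      exact hcon (by rw [hx])
    refine hJ (f_mem_span_of_source k hrn hsym l
      {z | l.color z = l.color x ∧ l.color (α.1 z) = l.color (α.1 x)} (y := x) (y' := x')
      ⟨rfl, rfl⟩ (fun h => hcon h.2) hx.symm hx0 (fun z hz => hz.1) α fun π hπ σ hσ e z => ?_)
    simp only [Set.mem_ofPred_eq, mem_young.1 hπ, eapp e, mem_young.1 hσ]
  -- A singleton block cannot cover a large block.
  have hback : ∀ x, α.1 x ∈ l.large → x ∈ l.large := by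
    intro x hx
    obtain ⟨y, hy, hne⟩ := Compos.exists_ne_of_mem_large hx
    obtain ⟨x', hx', rfl⟩ := hsurj x y hy
    by_contra hcon
    exact hne (by rw [Compos.eq_of_color_eq_of_notMem_large hcon hx'])
  have hsub : l.large ⊆ α.1 '' l.large := by
    intro y hy
    obtain ⟨x, hx⟩ := hmeet y hy
    obtain ⟨x', hx', rfl⟩ := hsurj x y hx.symm
    exact ⟨x', hback x' hy, rfl⟩
  -- The large points are covered by their own images, so by counting `α` permutes them.
  have heq : l.large = α.1 '' l.large :=
    Set.eq_of_subset_of_ncard_le hsub (Set.ncard_image_le l.large.toFinite)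
  have hinj : Set.InjOn α.1 l.large := Set.injOn_of_ncard_image_eq (by rw [← heq])
  exact exists_leftMonoid_dc_eq hp hl hlp hsym hS α hsurj hcol hinj fun x =>
    ⟨hback x, fun hx => heq ▸ Set.mem_image_of_mem _ hx⟩

end Representative

/-! ### The isomorphism from the monoid algebra of `leftMonoid` to `C_L^l`. -/

/-- The coefficient of a basis element, as a linear map. -/
def LAlg.coeffHom {M ι R : Type*} [Monoid M] [CommRing R] (G : ι → Subgroup Mˣ) (i j : ι)
    (D : DC G i j) : LAlg R G →ₗ[R] R where
  toFun x := x.coeff i j D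
  map_add' _ _ := rfl
  map_smul' _ _ := rfl

/-- The element `f(l, D, l)` of `B_L^l`. -/
noncomputable def fBL {r n : ℕ} (k : Type*) [Field k] (S : Submonoid (Function.End (Fin (r + 1))))
    (l : Compos r n) (D : DC (fun l : Compos r n => l.young S) l l) : BL k S l :=
  ⟨LAlg.f k l l D, LAlg.f_mem_corner l D⟩

section Iso

variable {r n p : ℕ} (k : Type*) [Field k] {S : Submonoid (Function.End (Fin (r + 1)))}
  {l : Compos r n}

theorem fAt_one : fAt k S l 1 = 1 := rfl

/-- Moving `ρ` to the left past `α` keeps `α ρ β` in the double coset of `α β`, and all three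
stabilizers are the full Young subgroup, so the one coefficient is `1`. -/
theorem fAt_mul (hp : p.Prime) (hl : l.IsPartition) (hlp : l.IsPPowers p) (hsym : sym r ≤ S)
    {α β : S} (hα : α.1 ∈ l.leftMonoid S p) (hβ : β.1 ∈ l.leftMonoid S p) :
    fAt k S l (α * β) = fAt k S l α * fAt k S l β := by
  refine Subtype.ext ?_
  refine (LAlg.f_mul_f (G := fun l : Compos r n => l.young S) (fun ρ hρ => ?_) ?_).symm
  · obtain ⟨σ, hσ, e⟩ := leftMonoid_mul_young hp hl hlp hsym hα hρ
    rw [e, ← dc_mul_mul hσ (one_mem (l.young S)) (α * β), Units.val_one, mul_one, mul_assoc]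
  · rw [nL_leftMonoid hp hl hlp hsym hα, nL_leftMonoid hp hl hlp hsym hβ,
      nL_leftMonoid hp hl hlp hsym (β := α * β) (mul_mem hα hβ)]

/-- `ψ_{l,L}` as a homomorphism of algebras. -/
noncomputable def psiHom (hp : p.Prime) (hl : l.IsPartition) (hlp : l.IsPPowers p)
    (hsym : sym r ≤ S) : MonoidAlgebra k (l.leftMonoid S p) →ₐ[k] BL k S l :=
  MonoidAlgebra.lift k (BL k S l) (l.leftMonoid S p)
    { toFun := fun α => fAt k S l ⟨α.1, α.2.1⟩
      map_one' := fAt_one k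
      map_mul' := fun α β => fAt_mul k hp hl hlp hsym (α := ⟨α.1, α.2.1⟩) (β := ⟨β.1, β.2.1⟩)
        α.2 β.2 }

theorem psiHom_single (hp : p.Prime) (hl : l.IsPartition) (hlp : l.IsPPowers p)
    (hsym : sym r ≤ S) (α : l.leftMonoid S p) (c : k) :
    psiHom k hp hl hlp hsym (MonoidAlgebra.single α c) = c • fAt k S l ⟨α.1, α.2.1⟩ :=
  MonoidAlgebra.lift_single _ _ _

theorem psiHom_eq (hp : p.Prime) (hl : l.IsPartition) (hlp : l.IsPPowers p)
    (hsym : sym r ≤ S) (x : MonoidAlgebra k (l.leftMonoid S p)) :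
    psiHom k hp hl hlp hsym x = psiL k S l p x := by
  have : (psiHom k hp hl hlp hsym).toLinearMap = psiL k S l p := by
    refine (MonoidAlgebra.basis (l.leftMonoid S p) k).ext fun α => ?_
    rw [MonoidAlgebra.basis_apply, AlgHom.toLinearMap_apply, psiHom_single, one_smul]
    simp [psiL]
  exact LinearMap.congr_fun this x

/-- Since distinct elements of `leftMonoid` have distinct double cosets, the coefficients of `x` can
be read off from its image. -/
theorem coeff_psiHom (hp : p.Prime) (hl : l.IsPartition) (hlp : l.IsPPowers p)
    (hsym : sym r ≤ S) (x : MonoidAlgebra k (l.leftMonoid S p)) (α : l.leftMonoid S p) :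
    (psiHom k hp hl hlp hsym x).1.coeff l l (dc _ l l ⟨α.1, α.2.1⟩) = x.coeff α := by
  let F : BL k S l →ₗ[k] k :=
    { toFun := fun y => y.1.coeff l l (dc _ l l ⟨α.1, α.2.1⟩)
      map_add' := fun _ _ => rfl
      map_smul' := fun _ _ => rfl }
  have : F ∘ₗ (psiHom k hp hl hlp hsym).toLinearMap =
      (MonoidAlgebra.basis (l.leftMonoid S p) k).coord α := by
    refine (MonoidAlgebra.basis (l.leftMonoid S p) k).ext fun β => ?_
    rw [LinearMap.comp_apply, MonoidAlgebra.basis_apply, AlgHom.toLinearMap_apply, psiHom_single,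
      one_smul]
    change (LAlg.f k l l (dc (fun l : Compos r n => l.young S) l l (⟨β.1, β.2.1⟩ : S))).coeff l l
      (dc _ l l (⟨α.1, α.2.1⟩ : S)) = _
    classical
    rw [LAlg.f_coeff, ← MonoidAlgebra.basis_apply, Module.Basis.coord_apply, Module.Basis.repr_self,
      Finsupp.single_apply]
    refine if_congr ⟨fun h => ?_, fun h => by rw [h]⟩ rfl rfl
    simp only [Sigma.mk.injEq, heq_eq_eq, true_and] at h
    have := leftMonoid_dc_inj hp hl hlp hsym (β := ⟨β.1, β.2.1⟩) (β' := ⟨α.1, α.2.1⟩) β.2 α.2 h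
    exact Subtype.ext (congrArg (fun s : S => s.1) this)
  exact LinearMap.congr_fun this x

/-- The ideal is additively generated by the products `a e_l b`, and each structure constant
entering such a coefficient is divisible by `p` by `dvd_coef`. -/
theorem coeff_eq_zero_of_mem_span [CharP k p] (hp : p.Prime) (hl : l.IsPartition)
    (hlp : l.IsPPowers p) (hsym : sym r ≤ S) (hS : S ≤ tauBar r) {y : LGS k S n}
    (hy : y ∈ TwoSidedIdeal.span {eBelow k S l}) {α : S} (hα : α.1 ∈ l.leftMonoid S p) :
    y.coeff l l (dc _ l l α) = 0 := by
  classical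
  rw [TwoSidedIdeal.mem_span_iff_mem_addSubgroup_closure] at hy
  change LAlg.coeffHom (fun l : Compos r n => l.young S) l l (dc _ l l α) y = 0
  induction hy using AddSubgroup.closure_induction with
  | mem y hy =>
    obtain ⟨_, ⟨a, _, e, rfl, rfl⟩, b, _, rfl⟩ := hy
    change (a * eBelow k S l * b).coeff l l (dc _ l l α) = 0
    rw [eBelow_eq_diag]
    refine LAlg.mul_diag_mul_coeff_eq_zero _ _ _ _ _ _ fun m D₁ D₂ hm => ?_
    have hm' : m.Below l := by
      by_contra h
      exact hm (if_neg h)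
    rw [CharP.cast_eq_zero_iff k p]
    refine dvd_coef hp hsym hS hlp hm' α (nL_leftMonoid hp hl hlp hsym hα) ?_ ?_ D₁ D₂
    · intro x i hx hi
      exact Compos.ne_zero_of_mem_large
        ((leftMonoid_mem_large_iff hp hl hlp hα x).2 ⟨i, hx, hi⟩)
    · intro x y i j hx hi hy hj h
      exact leftMonoid_injOn hp hl hlp hα ⟨i, hx, hi⟩ ⟨j, hy, hj⟩ h
  | zero => exact map_zero _
  | add x y _ _ hx hy => rw [map_add, hx, hy, add_zero]
  | neg x _ hx => rw [map_neg, hx, neg_zero]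

theorem BL_eq_sum (y : BL k S l) : y = ∑ D : DC (fun l : Compos r n => l.young S) l l,
    y.1.coeff l l D • fBL k S l D := by
  classical
  refine Subtype.ext (LAlg.ext' fun i j D => ?_)
  have hsum : (∑ D : DC (fun l : Compos r n => l.young S) l l,
      y.1.coeff l l D • fBL k S l D).1.coeff i j D =
      ∑ E : DC (fun l : Compos r n => l.young S) l l,
        y.1.coeff l l E * (LAlg.f k l l E : LGS k S n).coeff i j D := by
    let F : BL k S l →ₗ[k] k :=
      { toFun := fun y => y.1.coeff i j D
        map_add' := fun _ _ => rfl
        map_smul' := fun _ _ => rfl }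
    exact map_sum F _ _
  rw [hsum]
  obtain ⟨z, hz⟩ := y
  have hy := (Subsemigroup.mem_corner_iff (isIdempotentElem_oneAt k S l)).1 hz
  change z.coeff i j D = ∑ E, z.coeff l l E * _
  have he : oneAt k S l = LAlg.diag _ := LAlg.idem_eq_diag l
  rw [he] at hy
  by_cases hi : i = l
  · subst hi
    by_cases hj : j = i
    · subst hj
      simp [LAlg.f_coeff]
    · rw [Finset.sum_eq_zero fun E _ => ?_, ← hy.2, LAlg.mul_diag_coeff, Pi.single_eq_of_ne hj,
        mul_zero]
      rw [LAlg.f_coeff, if_neg, mul_zero]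
      intro h
      simp only [Sigma.mk.injEq, Prod.mk.injEq] at h
      exact hj h.1.2.symm
  · rw [Finset.sum_eq_zero fun E _ => ?_, ← hy.1, LAlg.diag_mul_coeff, Pi.single_eq_of_ne hi,
      zero_mul]
    rw [LAlg.f_coeff, if_neg, mul_zero]
    intro h
    simp only [Sigma.mk.injEq, Prod.mk.injEq] at h
    exact hi h.1.1.symm

theorem projL_eq_zero_iff (y : BL k S l) :
    projL k S l y = 0 ↔ y.1 ∈ TwoSidedIdeal.span {eBelow k S l} :=
  Ideal.Quotient.eq_zero_iff_mem

theorem projL_psiHom_bijective [CharP k p] (hp : p.Prime) (hrn : r ≤ n) (hl : l.IsPartition)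
    (hlp : l.IsPPowers p) (hsym : sym r ≤ S) (hS : S ≤ tauBar r) :
    Function.Bijective ((projL k S l).comp (psiHom k hp hl hlp hsym)) := by
  constructor
  · rw [injective_iff_map_eq_zero]
    intro x hx
    rw [AlgHom.comp_apply, projL_eq_zero_iff] at hx
    ext α
    rw [← coeff_psiHom k hp hl hlp hsym]
    exact coeff_eq_zero_of_mem_span k hp hl hlp hsym hS hx (α := ⟨α.1, α.2.1⟩) α.2
  · intro z
    obtain ⟨y, rfl⟩ := Ideal.Quotient.mkₐ_surjective k (KL k S l) z
    change projL k S l y ∈ ((projL k S l).comp (psiHom k hp hl hlp hsym)).range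
    rw [BL_eq_sum k y, map_sum]
    refine Subalgebra.sum_mem _ fun D _ => ?_
    rw [map_smul (projL k S l)]
    refine Subalgebra.smul_mem _ ?_ _
    obtain ⟨α, rfl⟩ := dc_surj D
    obtain h | ⟨β, hβ, h⟩ := f_mem_span_or_exists_leftMonoid k hp hrn hl hlp hsym hS α
    · rw [(projL_eq_zero_iff k _).2 h]
      exact zero_mem _
    · refine ⟨MonoidAlgebra.single ⟨β.1, hβ⟩ 1, ?_⟩
      change projL k S l (psiHom k hp hl hlp hsym _) = _
      rw [psiHom_single, one_smul]
      exact congrArg (fun D => projL k S l (fBL k S l D)) h.symm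

end Iso

/-! ### Permutations of `{1, …, s}` as maps fixing `0`. -/

section Extension

/-- The extension of a permutation of `{1, …, s}` by `0 ↦ 0`. -/
def permExt (s : ℕ) : Equiv.Perm (Fin s) →* Function.End (Fin (s + 1)) where
  toFun π := fun x => Fin.cases 0 (fun j => (π j).succ) x
  map_one' := funext fun x => by cases x using Fin.cases <;> rfl
  map_mul' _ _ := funext fun x => by cases x using Fin.cases <;> rfl

theorem permExt_succ {s : ℕ} (π : Equiv.Perm (Fin s)) (j : Fin s) :
    permExt s π j.succ = (π j).succ := rfl

theorem permExt_mem_sym {s : ℕ} (π : Equiv.Perm (Fin s)) : permExt s π ∈ sym s := by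
  refine ⟨rfl, Finite.injective_iff_bijective.1 fun x y h => ?_⟩
  cases x using Fin.cases <;> cases y using Fin.cases
  · rfl
  · exact absurd h (Fin.succ_ne_zero _).symm
  · exact absurd h (Fin.succ_ne_zero _)
  · rw [permExt_succ, permExt_succ, Fin.succ_inj] at h
    rw [π.injective h]

theorem exists_permExt_eq {s : ℕ} {α : Function.End (Fin (s + 1))} (hα : α ∈ sym s) :
    ∃ π, permExt s π = α := by
  have hne : ∀ j : Fin s, α j.succ ≠ 0 := fun j h =>
    Fin.succ_ne_zero j (hα.2.1 (h.trans hα.1.symm))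
  have hinj : Function.Injective fun j : Fin s => (α j.succ).pred (hne j) := fun j j' h =>
    Fin.succ_injective _ (hα.2.1 (Fin.pred_inj.1 h))
  refine ⟨Equiv.ofBijective _ (Finite.injective_iff_bijective.1 hinj), funext fun x => ?_⟩
  cases x using Fin.cases with
  | zero => exact hα.1.symm
  | succ j =>
    rw [permExt_succ, Equiv.ofBijective_apply, Fin.succ_pred]

theorem mem_sym_iff {s : ℕ} {α : Function.End (Fin (s + 1))} :
    α ∈ sym s ↔ α ∈ tau s ∧ α ∈ rook s := by
  constructor
  · intro h
    exact ⟨⟨h.1, fun j hj => h.2.1 (hj.trans h.1.symm)⟩,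
      ⟨h.1, fun i _ j j' hj hj' => h.2.1 (hj.trans hj'.symm)⟩⟩
  · rintro ⟨h, h'⟩
    refine ⟨h.1, Finite.injective_iff_bijective.1 fun x y hxy => ?_⟩
    by_cases hx : α x = 0
    · rw [h.2 x hx, h.2 y (hxy ▸ hx)]
    · exact h'.2 _ hx x y rfl hxy.symm

theorem exists_mul_eq_one_of_mem_sym {s : ℕ} {α : Function.End (Fin (s + 1))} (hα : α ∈ sym s) :
    ∃ γ ∈ sym s, α * γ = 1 := by
  obtain ⟨π, rfl⟩ := exists_permExt_eq hα
  exact ⟨_, permExt_mem_sym π⁻¹, by rw [← map_mul, mul_inv_cancel, map_one]⟩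

end Extension

/-! ### The monoid `S_0`. -/

section Head

variable {r n p : ℕ} {S : Submonoid (Function.End (Fin (r + 1)))} {l : Compos r n}

theorem apply_zero_of_mem {α : ∀ i, Function.End (Fin (l.mult p i + 1))}
    (h0 : α 0 ∈ tauBar _) (h1 : ∀ i, 0 < i → α i ∈ sym _) (i : ℕ) : α i 0 = 0 := by
  rcases Nat.eq_zero_or_pos i with rfl | hi
  · exact h0
  · exact (h1 i hi).1

namespace Compos.IsPhi

variable {α : ∀ i, Function.End (Fin (l.mult p i + 1))} {β : Function.End (Fin (r + 1))}

theorem mem_tauBar (h : l.IsPhi p α β) : β ∈ tauBar r := h.1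

/-- The components of positive index are permutations, so a nonzero point can be sent to `0` only at
level `0`. -/
theorem mem_tau_iff (hp : p.Prime) (hlp : l.IsPPowers p) (h : l.IsPhi p α β)
    (h0 : α 0 ∈ tauBar _) (h1 : ∀ i, 0 < i → α i ∈ sym _) : β ∈ tau r ↔ α 0 ∈ tau _ := by
  constructor
  · intro hβ
    refine ⟨h0, fun a ha => by_contra fun hne => ?_⟩
    obtain ⟨x, hx⟩ := Compos.exists_pt (p := p) hne le_rfl (Nat.one_le_pow 0 p hp.pos)
    exact hx.ne_zero (hβ.2 x (h.eq_zero hx ha))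
  · intro hα
    refine ⟨h.1, fun x hx => by_contra fun hne => ?_⟩
    obtain ⟨i, a, b, hxp⟩ := Compos.exists_isPt hp hlp hne
    have ha := (h.eq_zero_iff hxp).1 hx
    rcases Nat.eq_zero_or_pos i with rfl | hi
    · exact hxp.1 (hα.2 a ha)
    · exact hxp.1 ((h1 i hi).2.1 (ha.trans (h1 i hi).1.symm))

theorem mem_rook_iff (hp : p.Prime) (hlp : l.IsPPowers p) (h : l.IsPhi p α β)
    (h0 : α 0 ∈ tauBar _) (h1 : ∀ i, 0 < i → α i ∈ sym _) : β ∈ rook r ↔ α 0 ∈ rook _ := by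
  constructor
  · intro hβ
    refine ⟨h0, fun c hc a a' ha ha' => ?_⟩
    have hne : ∀ {a}, α 0 a = c → a ≠ 0 := by
      rintro _ h rfl
      exact hc (h.symm.trans h0)
    obtain ⟨x, hx⟩ := Compos.exists_pt (p := p) (hne ha) le_rfl (Nat.one_le_pow 0 p hp.pos)
    obtain ⟨x', hx'⟩ := Compos.exists_pt (p := p) (hne ha') le_rfl (Nat.one_le_pow 0 p hp.pos)
    have e := h.isPt hx (ha ▸ hc)
    have e' := h.isPt hx' (ha' ▸ hc)
    rw [ha] at e
    rw [ha'] at e'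
    obtain rfl := hβ.2 _ e.ne_zero x x' rfl (e'.eq e)
    exact Fin.ext (hx.unique hp hlp hx').2.1
  · intro hα
    refine ⟨h.1, fun y hy x x' hx hx' => ?_⟩
    have hne : ∀ {x}, β x = y → x ≠ 0 := by
      rintro _ h' rfl
      exact hy (h'.symm.trans h.1)
    obtain ⟨i, a, b, hxp⟩ := Compos.exists_isPt hp hlp (hne hx)
    obtain ⟨i', a', b', hxp'⟩ := Compos.exists_isPt hp hlp (hne hx')
    have e := h.isPt hxp (mt (h.eq_zero hxp) (hx ▸ hy))
    have e' := h.isPt hxp' (mt (h.eq_zero hxp') (hx' ▸ hy))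
    rw [hx] at e
    rw [hx'] at e'
    obtain ⟨rfl, ha, rfl⟩ := e.unique hp hlp e'
    have : a = a' := by
      rcases Nat.eq_zero_or_pos i with rfl | hi
      · exact hα.2 _ e.1 a a' rfl (Fin.ext ha).symm
      · exact (h1 i hi).2.1 (Fin.ext ha)
    subst this
    exact hxp.eq hxp'

theorem mem_sym_iff (hp : p.Prime) (hlp : l.IsPPowers p) (h : l.IsPhi p α β)
    (h0 : α 0 ∈ tauBar _) (h1 : ∀ i, 0 < i → α i ∈ sym _) : β ∈ sym r ↔ α 0 ∈ sym _ := by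
  rw [GSchur.mem_sym_iff, GSchur.mem_sym_iff, h.mem_tau_iff hp hlp h0 h1,
    h.mem_rook_iff hp hlp h0 h1]

end Compos.IsPhi

/-- The family with the component `α` at `0` and all other components trivial. -/
def headFamily (p : ℕ) (l : Compos r n) (α : Function.End (Fin (l.mult p 0 + 1))) :
    ∀ i, Function.End (Fin (l.mult p i + 1))
  | 0 => α
  | _ + 1 => 1

theorem headFamily_mem_sym (α : Function.End (Fin (l.mult p 0 + 1))) (i : ℕ) (hi : 0 < i) :
    headFamily p l α i ∈ sym _ := by
  cases i with
  | zero => exact absurd hi (lt_irrefl _)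
  | succ i => exact one_mem _

/-- The monoid `S_0` of those maps `α` of `{0, …, s_0}` for which `φ_l (α, 1, 1, …)` is in `S`. -/
def headMonoid (S : Submonoid (Function.End (Fin (r + 1)))) (p : ℕ) (l : Compos r n) :
    Submonoid (Function.End (Fin (l.mult p 0 + 1))) where
  carrier := {α | α ∈ tauBar _ ∧ ∃ β ∈ S, l.IsPhi p (headFamily p l α) β}
  one_mem' := by
    refine ⟨one_mem _, 1, one_mem _, ?_⟩
    convert Compos.isPhi_one (p := p) (l := l) using 1
    funext i
    cases i <;> rfl
  mul_mem' := by
    rintro α α' ⟨h0, β, hβ, h⟩ ⟨h0', β', hβ', h'⟩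
    refine ⟨mul_mem h0 h0', β * β', mul_mem hβ hβ', ?_⟩
    convert h.mul h' (apply_zero_of_mem h0 (headFamily_mem_sym α)) using 1
    funext i
    cases i <;> rfl

theorem headMonoid_le : headMonoid S p l ≤ tauBar _ := fun _ h => h.1

theorem mem_headMonoid_iff (hp : p.Prime) (hlp : l.IsPPowers p)
    {α : Function.End (Fin (l.mult p 0 + 1))} {β : Function.End (Fin (r + 1))}
    (hβ : l.IsPhi p (headFamily p l α) β) : α ∈ headMonoid S p l ↔ α ∈ tauBar _ ∧ β ∈ S := by
  refine and_congr_right fun _ => ⟨?_, fun h => ⟨β, h, hβ⟩⟩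
  rintro ⟨β', hβ', h⟩
  rwa [hβ.ext hp hlp h fun _ _ _ => rfl]

theorem headMonoid_eq (hp : p.Prime) (hlp : l.IsPPowers p) {T : Submonoid _}
    (hT : T ≤ tauBar (l.mult p 0))
    (h : ∀ α β, α ∈ tauBar _ → l.IsPhi p (headFamily p l α) β → (β ∈ S ↔ α ∈ T)) :
    headMonoid S p l = T := by
  ext α
  obtain ⟨β, hβ⟩ := Compos.exists_isPhi hp hlp (headFamily p l α)
  rw [mem_headMonoid_iff hp hlp hβ]
  exact ⟨fun h' => (h α β h'.1 hβ).1 h'.2, fun h' => ⟨hT h', (h α β (hT h') hβ).2 h'⟩⟩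

theorem sym_le_headMonoid (hp : p.Prime) (hlp : l.IsPPowers p) (hsym : sym r ≤ S) :
    sym _ ≤ headMonoid S p l := by
  intro α hα
  obtain ⟨β, hβ⟩ := Compos.exists_isPhi hp hlp (headFamily p l α)
  exact (mem_headMonoid_iff hp hlp hβ).2
    ⟨hα.1, hsym ((hβ.mem_sym_iff hp hlp hα.1 (headFamily_mem_sym α)).2 hα)⟩

/-- Families of permutations have their image under `φ_l` in `S`. Multiplying by such an image makes
the components of positive index trivial, or restores them, without leaving `S`. -/
theorem mem_leftMonoid_iff (hp : p.Prime) (hlp : l.IsPPowers p) (hsym : sym r ≤ S)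
    (β : Function.End (Fin (r + 1))) : β ∈ l.leftMonoid S p ↔
      ∃ α : ∀ i, Function.End (Fin (l.mult p i + 1)), α 0 ∈ headMonoid S p l ∧
        (∀ i, 0 < i → α i ∈ sym (l.mult p i)) ∧ l.IsPhi p α β := by
  have hphi : ∀ γ : ∀ i, Function.End (Fin (l.mult p i + 1)), (∀ i, γ i ∈ sym _) →
      ∃ δ ∈ S, l.IsPhi p γ δ := by
    intro γ hγ
    obtain ⟨δ, hδ⟩ := Compos.exists_isPhi hp hlp γ
    exact ⟨δ, hsym ((hδ.mem_sym_iff hp hlp (hγ 0).1 fun i _ => hγ i).2 (hγ 0)), hδ⟩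
  constructor
  · rintro ⟨hβ, α, h0, h1, h2⟩
    refine ⟨α, ⟨h0, ?_⟩, h1, h2⟩
    have hex : ∀ i, ∃ γ ∈ sym (l.mult p i), α i * γ = headFamily p l (α 0) i := by
      intro i
      cases i with
      | zero => exact ⟨1, one_mem _, mul_one _⟩
      | succ i => exact exists_mul_eq_one_of_mem_sym (h1 (i + 1) i.succ_pos)
    choose γ hγ hαγ using hex
    obtain ⟨δ, hδ, hγδ⟩ := hphi γ hγ
    refine ⟨β * δ, mul_mem hβ hδ, ?_⟩
    rw [← funext hαγ]
    exact h2.mul hγδ (apply_zero_of_mem h0 h1)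
  · rintro ⟨α, ⟨h0, β₀, hβ₀, h⟩, h1, h2⟩
    refine ⟨?_, α, h0, h1, h2⟩
    have hex : ∀ i, ∃ γ ∈ sym (l.mult p i), headFamily p l (α 0) i * γ = α i := by
      intro i
      cases i with
      | zero => exact ⟨1, one_mem _, mul_one _⟩
      | succ i => exact ⟨α (i + 1), h1 (i + 1) i.succ_pos, one_mul _⟩
    choose γ hγ hαγ using hex
    obtain ⟨δ, hδ, hγδ⟩ := hphi γ hγ
    have := h.mul hγδ (apply_zero_of_mem h0 (headFamily_mem_sym (α 0)))
    rw [funext hαγ] at this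
    rw [h2.ext hp hlp this fun _ _ _ => rfl]
    exact mul_mem hβ₀ hδ

end Head

/-! ### Monoid algebras of finite products as tensor products. -/

section Tensor

/-- The algebra map induced by a monoid homomorphism onto a basis is bijective. -/
theorem lift_bijective_of_basis {k M A : Type*} [Field k] [Monoid M] [Semiring A] [Algebra k A]
    (F : M →* A) (b : Module.Basis M k A) (h : ∀ m, b m = F m) :
    Function.Bijective (MonoidAlgebra.lift k A M F) := by
  have : (MonoidAlgebra.lift k A M F).toLinearMap =
      ((MonoidAlgebra.basis M k).equiv b (Equiv.refl M)).toLinearMap := by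
    refine (MonoidAlgebra.basis M k).ext fun m => ?_
    rw [LinearEquiv.coe_coe, Module.Basis.equiv_apply, Equiv.refl_apply, h,
      MonoidAlgebra.basis_apply, AlgHom.toLinearMap_apply, MonoidAlgebra.lift_single, one_smul]
  have h2 : ⇑(MonoidAlgebra.lift k A M F) =
      (MonoidAlgebra.basis M k).equiv b (Equiv.refl M) := funext fun x => LinearMap.congr_fun this x
  rw [h2]
  exact LinearEquiv.bijective _

theorem nonempty_monoidAlgebra_prod_algEquiv_of_basis {k : Type*} [Field k] {M : Type*} [Monoid M]
    {ι : Type*} [Finite ι] {P : ι → Type*} [∀ i, Monoid (P i)] {B : Type*} [Semiring B]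
    [Algebra k B] {A : ι → Type*} [∀ i, Semiring (A i)] [∀ i, Algebra k (A i)] (F : M →* B)
    (b : Module.Basis M k B) (hb : ∀ m, b m = F m) (F' : ∀ i, P i →* A i)
    (b' : ∀ i, Module.Basis (P i) k (A i)) (hb' : ∀ i m, b' i m = F' i m) :
    Nonempty (MonoidAlgebra k (M × ∀ i, P i) ≃ₐ[k] B ⊗[k] (⨂[k] i, A i)) := by
  -- Pure tensors of basis elements multiply componentwise and form a basis indexed by the product
  -- monoid.
  let H : (M × ∀ i, P i) →* B ⊗[k] (⨂[k] i, A i) :=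
    { toFun := fun x => F x.1 ⊗ₜ PiTensorProduct.tprod k fun i => F' i (x.2 i)
      map_one' := by
        simp only [Prod.fst_one, Prod.snd_one, Pi.one_apply, map_one]
        rfl
      map_mul' := fun x y => by
        rw [Algebra.TensorProduct.tmul_mul_tmul, PiTensorProduct.tprod_mul_tprod, ← map_mul]
        congr 2
        funext i
        exact map_mul (F' i) _ _ }
  refine ⟨AlgEquiv.ofBijective _ (lift_bijective_of_basis H
    (b.tensorProduct (Basis.piTensorProduct b')) fun x => ?_)⟩
  rw [Module.Basis.tensorProduct_apply', Basis.piTensorProduct_apply, hb]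
  simp only [hb']
  rfl

theorem nonempty_monoidAlgebra_prod_algEquiv (k : Type*) [Field k] (M : Type*) [Monoid M]
    {ι : Type*} [Finite ι] (P : ι → Type*) [∀ i, Monoid (P i)] :
    Nonempty (MonoidAlgebra k (M × ∀ i, P i) ≃ₐ[k]
      MonoidAlgebra k M ⊗[k] (⨂[k] i, MonoidAlgebra k (P i))) :=
  nonempty_monoidAlgebra_prod_algEquiv_of_basis (MonoidAlgebra.of k M) (MonoidAlgebra.basis M k)
    (fun _ => rfl) (fun i => MonoidAlgebra.of k (P i)) (fun i => MonoidAlgebra.basis (P i) k)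
    fun _ _ => rfl

end Tensor

/-! ### `leftMonoid` as a direct product. -/

section Decomposition

variable {r n p : ℕ} {S : Submonoid (Function.End (Fin (r + 1)))} {l : Compos r n}

/-- The family of maps attached to a map on the blocks of size one and permutations of the blocks of
each larger size. -/
def family (p : ℕ) (l : Compos r n) (α : Function.End (Fin (l.mult p 0 + 1)))
    (π : ∀ i : {i : ℕ // 0 < i ∧ 0 < l.mult p i}, Equiv.Perm (Fin (l.mult p i))) :
    ∀ i, Function.End (Fin (l.mult p i + 1))
  | 0 => α
  | i + 1 => if h : 0 < l.mult p (i + 1) then permExt _ (π ⟨i + 1, i.succ_pos, h⟩) else 1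

theorem family_succ (α : Function.End (Fin (l.mult p 0 + 1)))
    (π : ∀ i : {i : ℕ // 0 < i ∧ 0 < l.mult p i}, Equiv.Perm (Fin (l.mult p i))) (i : ℕ) :
    family p l α π (i + 1) =
      if h : 0 < l.mult p (i + 1) then permExt _ (π ⟨i + 1, i.succ_pos, h⟩) else 1 := rfl

theorem family_of_pos (α : Function.End (Fin (l.mult p 0 + 1)))
    (π : ∀ i : {i : ℕ // 0 < i ∧ 0 < l.mult p i}, Equiv.Perm (Fin (l.mult p i)))
    (i : {i : ℕ // 0 < i ∧ 0 < l.mult p i}) : family p l α π i = permExt _ (π i) := by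
  obtain ⟨_ | i, hi, h⟩ := i
  · exact absurd hi (lt_irrefl _)
  · exact dif_pos h

theorem family_mem_sym (α : Function.End (Fin (l.mult p 0 + 1)))
    (π : ∀ i : {i : ℕ // 0 < i ∧ 0 < l.mult p i}, Equiv.Perm (Fin (l.mult p i))) (i : ℕ)
    (hi : 0 < i) : family p l α π i ∈ sym _ := by
  cases i with
  | zero => exact absurd hi (lt_irrefl _)
  | succ i =>
    rw [family_succ]
    split_ifs
    · exact permExt_mem_sym _
    · exact one_mem _

theorem family_one : family p l 1 1 = fun _ => 1 := by
  funext i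
  cases i with
  | zero => rfl
  | succ i =>
    rw [family_succ]
    split_ifs
    · exact map_one _
    · rfl

theorem family_mul (α α' : Function.End (Fin (l.mult p 0 + 1)))
    (π π' : ∀ i : {i : ℕ // 0 < i ∧ 0 < l.mult p i}, Equiv.Perm (Fin (l.mult p i))) :
    family p l (α * α') (π * π') = fun i => family p l α π i * family p l α' π' i := by
  funext i
  cases i with
  | zero => rfl
  | succ i =>
    rw [family_succ, family_succ, family_succ]
    split_ifs
    · exact map_mul _ _ _
    · rfl

theorem mult_eq_zero_of_lt (hp : p.Prime) {i : ℕ} (hi : r < i) : l.mult p i = 0 := by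
  rw [Compos.mult, Finset.card_eq_zero, Finset.filter_eq_empty_iff]
  intro j _ hj
  have h1 := Nat.lt_pow_self hp.one_lt (n := i)
  have h2 : l.1 j ≤ r := by
    conv_rhs => rw [← l.2]
    exact Finset.single_le_sum (f := l.1) (fun _ _ => Nat.zero_le _) (Finset.mem_univ j)
  omega

/-- No part equals `p ^ i` once `i > r`. Finiteness is what the basis of the tensor product
requires. -/
theorem finite_levels (hp : p.Prime) : Finite {i : ℕ // 0 < i ∧ 0 < l.mult p i} := by
  refine Set.Finite.subset (Set.finite_Iic r) fun i hi => ?_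
  by_contra h
  exact hi.2.ne' (mult_eq_zero_of_lt hp (not_le.1 h))

/-- `S_{r,L}^l` is the product of `S_0` and the symmetric groups on the sets of large blocks of
equal size. -/
theorem nonempty_leftMonoid_mulEquiv (hp : p.Prime) (hlp : l.IsPPowers p) (hsym : sym r ≤ S) :
    Nonempty (headMonoid S p l ×
      (∀ i : {i : ℕ // 0 < i ∧ 0 < l.mult p i}, Equiv.Perm (Fin (l.mult p i))) ≃*
        l.leftMonoid S p) := by
  choose φ hφ using fun x : headMonoid S p l ×
    (∀ i : {i : ℕ // 0 < i ∧ 0 < l.mult p i}, Equiv.Perm (Fin (l.mult p i))) =>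
      Compos.exists_isPhi hp hlp (family p l x.1.1 x.2)
  have hmem : ∀ x, φ x ∈ l.leftMonoid S p := fun x =>
    (mem_leftMonoid_iff hp hlp hsym _).2 ⟨_, x.1.2, family_mem_sym _ _, hφ x⟩
  have hone : φ 1 = 1 := by
    refine (hφ 1).ext hp hlp Compos.isPhi_one fun i a _ => ?_
    exact congrFun (congrFun family_one i) a
  have hmul : ∀ x y, φ (x * y) = φ x * φ y := fun x y => by
    refine (hφ (x * y)).ext hp hlp ((hφ x).mul (hφ y) (apply_zero_of_mem
      (headMonoid_le x.1.2) (family_mem_sym _ _))) fun i a _ => ?_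
    exact congrFun (congrFun (family_mul _ _ _ _) i) a
  let Φ : headMonoid S p l ×
      (∀ i : {i : ℕ // 0 < i ∧ 0 < l.mult p i}, Equiv.Perm (Fin (l.mult p i))) →*
        l.leftMonoid S p :=
    { toFun := fun x => ⟨φ x, hmem x⟩
      map_one' := Subtype.ext hone
      map_mul' := fun x y => Subtype.ext (hmul x y) }
  refine ⟨MulEquiv.ofBijective Φ ⟨fun x y hxy => ?_, fun β => ?_⟩⟩
  · have hxy' : φ x = φ y := congrArg Subtype.val hxy
    have hy := hφ y
    rw [← hxy'] at hy
    have key : ∀ i a, family p l x.1.1 x.2 i a = family p l y.1.1 y.2 i a := by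
      intro i a
      by_cases ha : a = 0
      · rw [ha, apply_zero_of_mem (headMonoid_le x.1.2) (family_mem_sym _ _),
          apply_zero_of_mem (headMonoid_le y.1.2) (family_mem_sym _ _)]
      · exact (hφ x).inj hp hlp hy ha
    refine Prod.ext (Subtype.ext (funext (key 0))) (funext fun i => Equiv.ext fun j => ?_)
    have := key i j.succ
    rwa [family_of_pos, family_of_pos, permExt_succ, permExt_succ, Fin.succ_inj] at this
  · obtain ⟨α, h0, h1, h2⟩ := (mem_leftMonoid_iff hp hlp hsym _).1 β.2
    choose π hπ using fun i : {i : ℕ // 0 < i ∧ 0 < l.mult p i} => exists_permExt_eq (h1 i i.2.1)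
    refine ⟨(⟨α 0, h0⟩, π), Subtype.ext ((hφ _).ext hp hlp h2 fun i a ha => ?_)⟩
    rcases Nat.eq_zero_or_pos i with rfl | hi
    · rfl
    -- A nonzero `a` exists only at a level that has blocks, so the trivial default of `family` at
    -- empty levels does no harm.
    · have hm : 0 < l.mult p i := by
        have := a.2
        have : (a : ℕ) ≠ 0 := fun h => ha (Fin.ext h)
        omega
      rw [family_of_pos _ _ ⟨i, hi, hm⟩, hπ]

end Decomposition

end GSchur

theorem proposition8p1 (k : Type*) [Field k] (p : ℕ) [Fact p.Prime] [CharP k p]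
    (r n : ℕ) (hrn : r ≤ n) (S : Submonoid (Function.End (Fin (r + 1))))
    (hsym : GSchur.sym r ≤ S) (hS : S ≤ GSchur.tauBar r)
    (l : GSchur.Compos r n) (hl : l.IsPartition) (hlp : l.IsPPowers p) :
    (∃ Θ : MonoidAlgebra k (l.leftMonoid S p) ≃ₐ[k] GSchur.CL k S l,
      ∀ x, Θ x = GSchur.projL k S l (GSchur.psiL k S l p x)) ∧
    ∃ S₀ : Submonoid (Function.End (Fin (l.mult p 0 + 1))),
      GSchur.sym (l.mult p 0) ≤ S₀ ∧ S₀ ≤ GSchur.tauBar (l.mult p 0) ∧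
      (∀ β, β ∈ l.leftMonoid S p ↔ ∃ α : ∀ i, Function.End (Fin (l.mult p i + 1)),
        α 0 ∈ S₀ ∧ (∀ i, 0 < i → α i ∈ GSchur.sym (l.mult p i)) ∧ l.IsPhi p α β) ∧
      Nonempty (GSchur.CL k S l ≃ₐ[k]
        MonoidAlgebra k S₀ ⊗[k]
          (⨂[k] i : {i : ℕ // 0 < i ∧ 0 < l.mult p i},
            MonoidAlgebra k (Equiv.Perm (Fin (l.mult p i))))) ∧
      (S = GSchur.sym r → S₀ = GSchur.sym (l.mult p 0)) ∧
      (S = GSchur.tau r → S₀ = GSchur.tau (l.mult p 0)) ∧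
      (S = GSchur.rook r → S₀ = GSchur.rook (l.mult p 0)) ∧
      (S = GSchur.tauBar r → S₀ = GSchur.tauBar (l.mult p 0)) := by
  have hp : p.Prime := Fact.out
  let Θ := AlgEquiv.ofBijective _ (GSchur.projL_psiHom_bijective k hp hrn hl hlp hsym hS)
  have hhead : ∀ {T : Submonoid (Function.End (Fin (l.mult p 0 + 1)))},
      T ≤ GSchur.tauBar (l.mult p 0) → (∀ α β, α ∈ GSchur.tauBar _ →
        l.IsPhi p (GSchur.headFamily p l α) β → (β ∈ S ↔ α ∈ T)) → GSchur.headMonoid S p l = T :=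
    fun hT h => GSchur.headMonoid_eq hp hlp hT h
  refine ⟨⟨Θ, fun x => ?_⟩, GSchur.headMonoid S p l, GSchur.sym_le_headMonoid hp hlp hsym,
    GSchur.headMonoid_le, GSchur.mem_leftMonoid_iff hp hlp hsym, ?_, ?_, ?_, ?_, ?_⟩
  · rw [← GSchur.psiHom_eq k hp hl hlp hsym]
    rfl
  · have := GSchur.finite_levels (l := l) hp
    obtain ⟨e⟩ := GSchur.nonempty_leftMonoid_mulEquiv hp hlp hsym
    obtain ⟨t⟩ := GSchur.nonempty_monoidAlgebra_prod_algEquiv k (GSchur.headMonoid S p l)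
      fun i : {i : ℕ // 0 < i ∧ 0 < l.mult p i} => Equiv.Perm (Fin (l.mult p i))
    exact ⟨Θ.symm.trans ((MonoidAlgebra.domCongr k k e.symm).trans t)⟩
  · rintro rfl
    exact hhead (fun _ h => h.1) fun α β h0 h =>
      h.mem_sym_iff hp hlp h0 (GSchur.headFamily_mem_sym α)
  · rintro rfl
    exact hhead (fun _ h => h.1) fun α β h0 h =>
      h.mem_tau_iff hp hlp h0 (GSchur.headFamily_mem_sym α)
  · rintro rfl
    exact hhead (fun _ h => h.1) fun α β h0 h =>
      h.mem_rook_iff hp hlp h0 (GSchur.headFamily_mem_sym α)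
  · rintro rfl
    exact hhead le_rfl fun α β h0 h => ⟨fun _ => h0, fun _ => h.mem_tauBar⟩
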